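/- Let $\mathbb K$ be a field of characteristic $0$. For a finite set $I$ call two polytopes in $\mathbb R I$ normally equivalent if they have the same normal fan. For a linear order $\ell$ on a finite set $S$ let $a_\ell=\sum_{i\le_\ell j}\operatorname{conv}\{e_k : i\le_\ell k\le_\ell j\}\subseteq\mathbb R S$ (Minkowski sum) be the Loday associahedron. Let $\overline{\mathbf A}[I]$ be the $\mathbb K$-vector space with basis the normal equivalence classes of products $a_{\ell_1}\times\cdots\times a_{\ell_k}$, where $I=S_1\sqcup\cdots\sqcup S_k$ and $\ell_i$ is a linear order on $S_i$. It is a Hopf monoid in vector species: for $I=S\sqcup T$ the product is $\mu_{S,T}(P\otimes Q)=P\times Q$ and the coproduct is $\Delta_{S,T}(P)=P|_S\otimes P/_S$, where $P|_S\times P/_S$ is the face of $P$ on which the functional $\mathbf 1_S=\sum_{i\in S}e_i$ is maximal. Let $\overline{\mathbf A}^*$ be the dual Hopf monoid, with product $\mu^*$ dual to $\Delta$ and coproduct $\Delta^*$ dual to $\mu$. Let $A^*=\bigoplus_{n\ge 0}\big(\overline{\mathbf A}^*[n]\big)^{S_n}$ be the graded Hopf algebra obtained from $\overline{\mathbf A}^*$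 by the (invariants) Fock functor; equivalently, $A^*$ is the graded dual of $\bigoplus_n \overline{\mathbf A}[n]_{S_n}$, whose basis consists of the isomorphism classes of products of associahedra. The product of $f\in A^*_s$ and $g\in A^*_t$ is $\sum\mu^*_{S,T}(f_S\otimes g_T)$, the sum being over all $[s+t]=S\sqcup T$ with $|S|=s$, where $f_S$, $g_T$ are $f$, $g$ transported along the order-preserving bijections $[s]\cong S$, $[t]\cong T$; the component of the coproduct in bidegree $(s,t)$ is $\Delta^*_{\{1,\dots,s\},\{s+1,\dots,s+t\}}$. For $n\ge1$ let $a_n^*\in A^*_n$ be the functional dual to the isomorphism class of associahedra: it is $1$ on the class of $a_\ell$ for every linear order $\ell$ on $[n]$ and $0$ on all other basis elements. Let $\mathcal P(A^*)=\{x\in A^*:\Delta(x)=x\otimes1+1\otimes x\}$ be the space of primitive elements. Let $W=\operatorname{Der}_{\mathbb K}\mathbb K[z,z^{-1}]$ be the Witt algebra, $L_n=-z^{n+1}\frac{d}{dz}$ for $n\in\mathbb Z$, so that $[L_m,L_n]=(m-n)L_{m+n}$, and let $W_+=\operatorname{span}\{L_n:n\ge1\}$ be its positive part. **Theorem.** $\mathcal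 P(A^*)$ is closed under the commutator $[x,y]=xy-yx$ of $A^*$; the elements $a_n^*$, $n\ge 1$, lie in $\mathcal P(A^*)$ and satisfy $[a_m^*,a_n^*]=(m-n)\,a_{m+n}^*$; and there is an isomorphism of Lie algebras $\mathcal P(A^*)\to W_+$ that sends $a_n^*$ to $L_n$ for every $n\ge1$. -/

import Mathlib

namespace AssocWitt
noncomputable section
set_option linter.unusedSectionVars false
/-! ### Polytopes, normal fans, associahedra -/

section Polytopes
open scoped Pointwise Topology
open Filter
variable {I J : Type} [Fintype I] [Fintype J]

/-- A (nonempty) polytope in `ℝ I`: the convex hull of finitely many points. -/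
def IsPolytope (P : Set (I → ℝ)) : Prop :=
  ∃ V : Set (I → ℝ), V.Finite ∧ V.Nonempty ∧ P = convexHull ℝ V

/-- The `y`-maximal face of `P`. -/
def maxFace (P : Set (I → ℝ)) (y : I → ℝ) : Set (I → ℝ) :=
  {x | x ∈ P ∧ ∀ x' ∈ P, y ⬝ᵥ x' ≤ y ⬝ᵥ x}

/-- The normal cone of a face `F` of `P`: the functionals that attain their maximal value on `P`
at every point of `F`. -/
def normalCone (P F : Set (I → ℝ)) : Set (I → ℝ) :=
  {y | F ⊆ maxFace P y}

/-- The normal fan of a polytope `P`: the normal cones of all faces of `P`. -/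
def normalFan (P : Set (I → ℝ)) : Set (Set (I → ℝ)) :=
  {C | ∃ y, C = normalCone P (maxFace P y)}

theorem normalFan_eq_iff (P Q : Set (I → ℝ)) : normalFan P = normalFan Q ↔
    ∀ y y', (maxFace P y ⊆ maxFace P y' ↔ maxFace Q y ⊆ maxFace Q y') := by
  have key : ∀ P Q : Set (I → ℝ), normalFan P = normalFan Q →
      ∀ y y', maxFace P y ⊆ maxFace P y' → maxFace Q y ⊆ maxFace Q y' := by
    intro P Q h y y' hy
    have h1 : normalCone Q (maxFace Q y) ∈ normalFan P := h ▸ ⟨y, rfl⟩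
    obtain ⟨z, hz⟩ := h1
    have h2 : y ∈ normalCone P (maxFace P z) := by
      rw [← hz]; exact fun _ h => h
    have h3 : y' ∈ normalCone P (maxFace P z) := fun x hx => hy (h2 hx)
    rw [← hz] at h3
    exact h3
  constructor
  · intro h y y'
    exact ⟨key P Q h y y', key Q P h.symm y y'⟩
  · intro h
    have : ∀ y, normalCone P (maxFace P y) = normalCone Q (maxFace Q y) := fun y =>
      Set.ext fun y' => h y y'
    ext C
    simp only [normalFan, Set.mem_ofPred_eq, this]

theorem convex_maxFace {P : Set (I → ℝ)} (hP : Convex ℝ P) (y : I → ℝ) :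
    Convex ℝ (maxFace P y) := by
  intro a ha b hb s t hs ht hst
  refine ⟨hP ha.1 hb.1 hs ht hst, fun x hx => ?_⟩
  have h1 := ha.2 x hx
  have h2 := hb.2 x hx
  rw [dotProduct_add, dotProduct_smul, dotProduct_smul, smul_eq_mul, smul_eq_mul]
  have : y ⬝ᵥ x = s * (y ⬝ᵥ x) + t * (y ⬝ᵥ x) := by rw [← add_mul, hst, one_mul]
  nlinarith [mul_le_mul_of_nonneg_left h1 hs, mul_le_mul_of_nonneg_left h2 ht]

theorem dot_le_of_mem_convexHull {V : Set (I → ℝ)} {y : I → ℝ} {M : ℝ}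
    (h : ∀ v ∈ V, y ⬝ᵥ v ≤ M) {x : I → ℝ} (hx : x ∈ convexHull ℝ V) : y ⬝ᵥ x ≤ M := by
  have hc : Convex ℝ {x : I → ℝ | y ⬝ᵥ x ≤ M} :=
    convex_halfSpace_le ⟨fun a b => dotProduct_add y a b, fun c a => dotProduct_smul c y a⟩ M
  exact convexHull_min h hc hx

theorem maxFace_convexHull (V : Set (I → ℝ)) (y : I → ℝ) :
    maxFace (convexHull ℝ V) y = convexHull ℝ {v | v ∈ V ∧ ∀ w ∈ V, y ⬝ᵥ w ≤ y ⬝ᵥ v} := by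
  apply Set.Subset.antisymm
  · rintro x ⟨hx, hmax⟩
    set W := {v | v ∈ V ∧ ∀ w ∈ V, y ⬝ᵥ w ≤ y ⬝ᵥ v} with hW
    have hVx : ∀ v ∈ V, y ⬝ᵥ v ≤ y ⬝ᵥ x := fun v hv => hmax v (subset_convexHull ℝ V hv)
    have hWx : ∀ z ∈ convexHull ℝ W, y ⬝ᵥ z ≤ y ⬝ᵥ x := fun z hz =>
      dot_le_of_mem_convexHull (fun v hv => hVx v hv.1) hz
    have hconv : Convex ℝ ({z | y ⬝ᵥ z < y ⬝ᵥ x} ∪ convexHull ℝ W) := by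
      rw [convex_iff_forall_pos]
      intro a ha b hb s t hs ht hst
      have hle : ∀ c ∈ ({z | y ⬝ᵥ z < y ⬝ᵥ x} ∪ convexHull ℝ W), y ⬝ᵥ c ≤ y ⬝ᵥ x := by
        rintro c (hc | hc)
        · exact le_of_lt hc
        · exact hWx c hc
      have e : y ⬝ᵥ (s • a + t • b) = s * (y ⬝ᵥ a) + t * (y ⬝ᵥ b) := by
        rw [dotProduct_add, dotProduct_smul, dotProduct_smul, smul_eq_mul, smul_eq_mul]
      have e2 : y ⬝ᵥ x = s * (y ⬝ᵥ x) + t * (y ⬝ᵥ x) := by rw [← add_mul, hst, one_mul]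
      have hla := hle a ha
      have hlb := hle b hb
      rcases ha with ha | ha
      · left
        simp only [Set.mem_ofPred_eq] at ha ⊢
        rw [e]
        nlinarith [mul_lt_mul_of_pos_left ha hs, mul_le_mul_of_nonneg_left hlb ht.le]
      · rcases hb with hb | hb
        · left
          simp only [Set.mem_ofPred_eq] at hb ⊢
          rw [e]
          nlinarith [mul_lt_mul_of_pos_left hb ht, mul_le_mul_of_nonneg_left hla hs.le]
        · right
          exact convex_convexHull ℝ W ha hb hs.le ht.le hst
    have hsub : V ⊆ {z | y ⬝ᵥ z < y ⬝ᵥ x} ∪ convexHull ℝ W := by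
      intro v hv
      rcases lt_or_eq_of_le (hVx v hv) with h | h
      · left; exact h
      · right
        refine subset_convexHull ℝ W ⟨hv, fun w hw => ?_⟩
        rw [h]; exact hVx w hw
    rcases convexHull_min hsub hconv hx with h | h
    · have h' : y ⬝ᵥ x < y ⬝ᵥ x := h
      exact absurd h' (lt_irrefl _)
    · exact h
  · refine convexHull_min ?_ (convex_maxFace (convex_convexHull ℝ V) y)
    rintro v ⟨hv, hmax⟩
    exact ⟨subset_convexHull ℝ V hv, fun x' hx' => dot_le_of_mem_convexHull hmax hx'⟩

namespace IsPolytope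

theorem convex {P : Set (I → ℝ)} (hP : IsPolytope P) : Convex ℝ P := by
  obtain ⟨V, -, -, rfl⟩ := hP
  exact convex_convexHull ℝ V

theorem maxFace {P : Set (I → ℝ)} (hP : IsPolytope P) (y : I → ℝ) :
    IsPolytope (maxFace P y) := by
  obtain ⟨V, hf, hn, rfl⟩ := hP
  refine ⟨_, hf.subset (fun v hv => hv.1), ?_, maxFace_convexHull V y⟩
  obtain ⟨v, hv, h⟩ := Set.exists_max_image V (fun v => y ⬝ᵥ v) hf hn
  exact ⟨v, hv, h⟩

theorem nonempty {P : Set (I → ℝ)} (hP : IsPolytope P) : P.Nonempty := by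
  obtain ⟨V, -, hn, rfl⟩ := hP
  exact hn.mono (subset_convexHull ℝ V)

theorem add {P Q : Set (I → ℝ)} (hP : IsPolytope P) (hQ : IsPolytope Q) :
    IsPolytope (P + Q) := by
  obtain ⟨V, hVf, hVn, rfl⟩ := hP
  obtain ⟨W, hWf, hWn, rfl⟩ := hQ
  exact ⟨V + W, hVf.add hWf, hVn.add hWn, (convexHull_add V W).symm⟩

theorem image {P : Set (I → ℝ)} (hP : IsPolytope P) (f : (I → ℝ) →ₗ[ℝ] (J → ℝ)) :
    IsPolytope (f '' P) := by
  obtain ⟨V, hVf, hVn, rfl⟩ := hP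
  exact ⟨f '' V, hVf.image f, hVn.image f, f.image_convexHull V⟩

theorem finset_sum {ι : Type} (s : Finset ι) (P : ι → Set (I → ℝ))
    (hP : ∀ k ∈ s, IsPolytope (P k)) : IsPolytope (∑ k ∈ s, P k) := by
  classical
  induction s using Finset.induction_on with
  | empty => exact ⟨{0}, Set.finite_singleton 0, Set.singleton_nonempty 0, by simp; rfl⟩
  | insert a s ha ih =>
    rw [Finset.sum_insert ha]
    exact (hP a (Finset.mem_insert_self a s)).add
      (ih fun k hk => hP k (Finset.mem_insert_of_mem hk))

/-- For small `ε > 0` the `(u + ε y)`-maximal face is the `y`-maximal face of the `u`-maximal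
face. -/
theorem eventually_maxFace {P : Set (I → ℝ)} (hP : IsPolytope P) (u y : I → ℝ) :
    ∀ᶠ ε in 𝓝[>] (0 : ℝ),
      AssocWitt.maxFace P (u + ε • y) = AssocWitt.maxFace (AssocWitt.maxFace P u) y := by
  obtain ⟨g, hg⟩ := ((hP.maxFace u).maxFace y).nonempty
  obtain ⟨V, hVf, hVn, hPV⟩ := hP
  have hdot : ∀ (ε : ℝ) (x : I → ℝ), (u + ε • y) ⬝ᵥ x = u ⬝ᵥ x + ε * (y ⬝ᵥ x) := by
    intro ε x; rw [add_dotProduct, smul_dotProduct, smul_eq_mul]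
  have hev : ∀ᶠ ε in 𝓝[>] (0 : ℝ), ∀ v ∈ V, (u + ε • y) ⬝ᵥ v ≤ (u + ε • y) ⬝ᵥ g := by
    rw [eventually_all_finite hVf]
    intro v hv
    have hvP : v ∈ P := hPV ▸ subset_convexHull ℝ V hv
    have huv := hg.1.2 v hvP
    rcases lt_or_eq_of_le huv with h | h
    · have hc : Tendsto (fun ε : ℝ => u ⬝ᵥ g + ε * (y ⬝ᵥ g) - (u ⬝ᵥ v + ε * (y ⬝ᵥ v))) (𝓝[>] 0)
          (𝓝 (u ⬝ᵥ g + 0 * (y ⬝ᵥ g) - (u ⬝ᵥ v + 0 * (y ⬝ᵥ v)))) := by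
        apply Tendsto.mono_left _ nhdsWithin_le_nhds
        apply Continuous.tendsto
        fun_prop
      have := hc.eventually (lt_mem_nhds (by linarith : (0 : ℝ) < _))
      filter_upwards [this] with ε hε
      rw [hdot, hdot]; linarith
    · have hvF : v ∈ AssocWitt.maxFace P u := ⟨hvP, fun x hx => h ▸ hg.1.2 x hx⟩
      have hy := hg.2 v hvF
      filter_upwards [self_mem_nhdsWithin] with ε hε
      rw [hdot, hdot, h]
      have : (0 : ℝ) < ε := hε
      nlinarith
  obtain ⟨δ, hδ, hδV⟩ := (mem_nhdsGT_iff_exists_Ioo_subset.mp hev)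
  have hδ : (0 : ℝ) < δ := hδ
  have hle : ∀ ε ∈ Set.Ioo 0 δ, ∀ x ∈ P, (u + ε • y) ⬝ᵥ x ≤ (u + ε • y) ⬝ᵥ g := by
    intro ε hε x hx
    exact dot_le_of_mem_convexHull (hδV hε) (hPV ▸ hx)
  have hmem : Set.Ioo (0 : ℝ) (δ / 2) ∈ 𝓝[>] (0 : ℝ) := Ioo_mem_nhdsGT (by linarith)
  filter_upwards [hmem] with ε hε
  have hε1 : ε ∈ Set.Ioo 0 δ := ⟨hε.1, by linarith [hε.2]⟩
  apply Set.Subset.antisymm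
  · rintro x ⟨hx, hmax⟩
    have h0 := hg.1.2 x hx
    have h1 := hmax g hg.1.1
    have h2 := hle (2 * ε) ⟨by linarith [hε.1], by linarith [hε.2]⟩ x hx
    rw [hdot, hdot] at h1 h2
    have hpos := hε.1
    have hux : u ⬝ᵥ x = u ⬝ᵥ g := by linarith
    have hyx : y ⬝ᵥ g ≤ y ⬝ᵥ x := by
      rw [hux] at h1
      exact le_of_mul_le_mul_left (by linarith) hpos
    exact ⟨⟨hx, fun z hz => hux ▸ hg.1.2 z hz⟩, fun z hz => (hg.2 z hz).trans hyx⟩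
  · rintro x ⟨⟨hx, hxu⟩, hxy⟩
    refine ⟨hx, fun z hz => (hle ε hε1 z hz).trans ?_⟩
    rw [hdot, hdot]
    have h1 := hxu g hg.1.1
    have h2 := hxy g hg.1
    have hpos := hε.1
    nlinarith

end IsPolytope

theorem maxFace_image_subset_iff (f : (I → ℝ) →ₗ[ℝ] (J → ℝ)) (ft : (J → ℝ) → (I → ℝ))
    (hf : ∀ y x, y ⬝ᵥ f x = ft y ⬝ᵥ x) (P : Set (I → ℝ)) (y y' : J → ℝ) :
    maxFace (f '' P) y ⊆ maxFace (f '' P) y' ↔ maxFace P (ft y) ⊆ maxFace P (ft y') := by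
  have key : ∀ z x, x ∈ P → (f x ∈ maxFace (f '' P) z ↔ x ∈ maxFace P (ft z)) := by
    intro z x hx
    constructor
    · rintro ⟨-, h⟩
      refine ⟨hx, fun w hw => ?_⟩
      have := h (f w) ⟨w, hw, rfl⟩
      rwa [hf, hf] at this
    · rintro ⟨-, h⟩
      refine ⟨⟨x, hx, rfl⟩, ?_⟩
      rintro _ ⟨w, hw, rfl⟩
      rw [hf, hf]; exact h w hw
  constructor
  · intro h x hx
    exact (key y' x hx.1).1 (h ((key y x hx.1).2 hx))
  · rintro h _ ⟨⟨x, hx, rfl⟩, hx2⟩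
    exact (key y' x hx).2 (h ((key y x hx).1 ⟨⟨x, hx, rfl⟩, hx2⟩))

theorem maxFace_add_subset_iff {P Q : Set (I → ℝ)} (hP : IsPolytope P) (hQ : IsPolytope Q)
    (y y' : I → ℝ) : maxFace (P + Q) y ⊆ maxFace (P + Q) y' ↔
      maxFace P y ⊆ maxFace P y' ∧ maxFace Q y ⊆ maxFace Q y' := by
  have key : ∀ z, ∀ p ∈ P, ∀ q ∈ Q,
      (p + q ∈ maxFace (P + Q) z ↔ p ∈ maxFace P z ∧ q ∈ maxFace Q z) := by
    intro z p hp q hq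
    constructor
    · rintro ⟨-, h⟩
      refine ⟨⟨hp, fun w hw => ?_⟩, ⟨hq, fun w hw => ?_⟩⟩
      · have := h (w + q) (Set.add_mem_add hw hq)
        rw [dotProduct_add, dotProduct_add] at this
        linarith
      · have := h (p + w) (Set.add_mem_add hp hw)
        rw [dotProduct_add, dotProduct_add] at this
        linarith
    · rintro ⟨⟨-, h1⟩, ⟨-, h2⟩⟩
      refine ⟨Set.add_mem_add hp hq, ?_⟩
      rintro _ ⟨a, ha, b, hb, rfl⟩
      have := h1 a ha
      have := h2 b hb
      simp only [dotProduct_add]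
      linarith
  constructor
  · intro h
    obtain ⟨p0, hp0⟩ := (hP.maxFace y).nonempty
    obtain ⟨q0, hq0⟩ := (hQ.maxFace y).nonempty
    exact ⟨fun p hp => ((key y' p hp.1 q0 hq0.1).1 (h ((key y p hp.1 q0 hq0.1).2 ⟨hp, hq0⟩))).1,
      fun q hq => ((key y' p0 hp0.1 q hq.1).1 (h ((key y p0 hp0.1 q hq.1).2 ⟨hp0, hq⟩))).2⟩
  · rintro ⟨h1, h2⟩ x hx
    obtain ⟨p, hp, q, hq, rfl⟩ := hx.1
    have := (key y p hp q hq).1 hx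
    exact (key y' p hp q hq).2 ⟨h1 this.1, h2 this.2⟩

theorem maxFace_sum_subset_iff {ι : Type} (s : Finset ι) (P : ι → Set (I → ℝ))
    (hP : ∀ k ∈ s, IsPolytope (P k)) (y y' : I → ℝ) :
    maxFace (∑ k ∈ s, P k) y ⊆ maxFace (∑ k ∈ s, P k) y' ↔
      ∀ k ∈ s, maxFace (P k) y ⊆ maxFace (P k) y' := by
  classical
  induction s using Finset.induction_on with
  | empty =>
    simp only [Finset.sum_empty, Finset.notMem_empty, false_imp_iff, implies_true, iff_true]
    rintro x ⟨hx, -⟩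
    refine ⟨hx, fun z hz => ?_⟩
    rw [Set.mem_zero] at hx hz
    rw [hx, hz]
  | insert a s ha ih =>
    have hP' : ∀ k ∈ s, IsPolytope (P k) := fun k hk => hP k (Finset.mem_insert_of_mem hk)
    rw [Finset.sum_insert ha, maxFace_add_subset_iff (hP a (Finset.mem_insert_self a s))
      (IsPolytope.finset_sum s P hP'), ih hP', Finset.forall_mem_insert]


/-- The standard basis vector `e_i` of `ℝ I`. -/
def basisVec (i : I) : I → ℝ := Set.indicator {i} 1

theorem dot_basisVec (y : I → ℝ) (i : I) : y ⬝ᵥ basisVec i = y i := by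
  classical
  rw [dotProduct, Finset.sum_eq_single i]
  · simp [basisVec]
  · intro j _ hj; simp [basisVec, hj]
  · intro h; exact absurd (Finset.mem_univ i) h

/-- The simplex `Δ_S = conv {e_i : i ∈ S}`. -/
def simplex (S : Set I) : Set (I → ℝ) := convexHull ℝ (basisVec '' S)

theorem isPolytope_simplex {S : Set I} (hS : S.Nonempty) : IsPolytope (simplex S) :=
  ⟨_, (Set.toFinite S).image _, hS.image _, rfl⟩

/-- The elements of `S` at which `y` is maximal. -/
def argmax (S : Set I) (y : I → ℝ) : Set I := {i | i ∈ S ∧ ∀ j ∈ S, y j ≤ y i}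

theorem maxFace_simplex (S : Set I) (y : I → ℝ) :
    maxFace (simplex S) y = simplex (argmax S y) := by
  rw [simplex, maxFace_convexHull, simplex]
  congr 1
  ext v
  constructor
  · rintro ⟨⟨i, hi, rfl⟩, h⟩
    refine ⟨i, ⟨hi, fun j hj => ?_⟩, rfl⟩
    have := h _ ⟨j, hj, rfl⟩
    rwa [dot_basisVec, dot_basisVec] at this
  · rintro ⟨i, ⟨hi, h⟩, rfl⟩
    refine ⟨⟨i, hi, rfl⟩, ?_⟩
    rintro _ ⟨j, hj, rfl⟩
    rw [dot_basisVec, dot_basisVec]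
    exact h j hj

theorem basisVec_mem_maxFace_simplex {S : Set I} {y : I → ℝ} {i : I} :
    basisVec i ∈ maxFace (simplex S) y ↔ i ∈ argmax S y := by
  constructor
  · rintro ⟨h1, h2⟩
    have hi : i ∈ S := by
      by_contra hi
      have : ∀ v ∈ basisVec '' S, basisVec i ⬝ᵥ v ≤ 0 := by
        rintro _ ⟨j, hj, rfl⟩
        rw [dot_basisVec]
        have hji : j ≠ i := fun h => hi (h ▸ hj)
        simp [basisVec, hji]
      have := dot_le_of_mem_convexHull this h1
      rw [dot_basisVec] at this
      simp [basisVec] at this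
      linarith
    refine ⟨hi, fun j hj => ?_⟩
    have := h2 (basisVec j) (subset_convexHull ℝ _ ⟨j, hj, rfl⟩)
    rwa [dot_basisVec, dot_basisVec] at this
  · intro h
    rw [maxFace_simplex]
    exact subset_convexHull ℝ _ ⟨i, h, rfl⟩

theorem maxFace_simplex_subset_iff (S : Set I) (y y' : I → ℝ) :
    maxFace (simplex S) y ⊆ maxFace (simplex S) y' ↔ argmax S y ⊆ argmax S y' := by
  constructor
  · intro h i hi
    exact basisVec_mem_maxFace_simplex.1 (h (basisVec_mem_maxFace_simplex.2 hi))
  · intro h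
    rw [maxFace_simplex, maxFace_simplex]
    exact convexHull_mono (Set.image_mono h)

/-- The normal fan of `P` is the normal fan of the Minkowski sum of the simplices in `𝒥`. -/
def Gen (P : Set (I → ℝ)) (𝒥 : Set (Set I)) : Prop :=
  ∀ y y', maxFace P y ⊆ maxFace P y' ↔ ∀ S ∈ 𝒥, argmax S y ⊆ argmax S y'

theorem Gen.normalFan_eq {P Q : Set (I → ℝ)} {𝒥 : Set (Set I)} (hP : Gen P 𝒥) (hQ : Gen Q 𝒥) :
    normalFan P = normalFan Q :=
  (normalFan_eq_iff P Q).2 fun y y' => (hP y y').trans (hQ y y').symm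

theorem Gen.of_normalFan_eq {P Q : Set (I → ℝ)} {𝒥 : Set (Set I)} (hP : Gen P 𝒥)
    (h : normalFan P = normalFan Q) : Gen Q 𝒥 := fun y y' =>
  ((normalFan_eq_iff P Q).1 h y y').symm.trans (hP y y')

theorem Gen.maxFace {P : Set (I → ℝ)} {𝒥 : Set (Set I)} (hP : Gen P 𝒥) (hPol : IsPolytope P)
    (h𝒥 : ∀ S ∈ 𝒥, S.Nonempty) (u : I → ℝ) :
    Gen (maxFace P u) ((fun S => argmax S u) '' 𝒥) := by
  intro y y'
  have hev : ∀ z : I → ℝ, ∀ᶠ ε in 𝓝[>] (0 : ℝ), ∀ S ∈ 𝒥,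
      AssocWitt.maxFace (simplex S) (u + ε • z) =
        AssocWitt.maxFace (AssocWitt.maxFace (simplex S) u) z := by
    intro z
    rw [eventually_all_finite (Set.toFinite 𝒥)]
    intro S hS
    exact (isPolytope_simplex (h𝒥 S hS)).eventually_maxFace u z
  obtain ⟨ε, h1, h2, h3, h4⟩ := ((hPol.eventually_maxFace u y).and
    ((hPol.eventually_maxFace u y').and ((hev y).and (hev y')))).exists
  rw [← h1, ← h2, hP, Set.forall_mem_image]
  refine forall₂_congr fun S hS => ?_
  rw [← maxFace_simplex_subset_iff, h3 S hS, h4 S hS, maxFace_simplex S u,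
    maxFace_simplex_subset_iff]

/-- The set of intervals `[i, j]`, `i ≤ j`, of a reflexive relation. -/
def intervals (ρ : I → I → Prop) : Set (Set I) :=
  {S | ∃ i j, ρ i j ∧ S = {k | ρ i k ∧ ρ k j}}

theorem gen_loday_aux {ι : Type} (s : Finset ι) (𝒥 : ι → Set I)
    (h𝒥 : ∀ k ∈ s, (𝒥 k).Nonempty) :
    Gen (∑ k ∈ s, simplex (𝒥 k)) (𝒥 '' s) := by
  intro y y'
  rw [maxFace_sum_subset_iff s _ (fun k hk => isPolytope_simplex (h𝒥 k hk)), Set.forall_mem_image]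
  exact forall₂_congr fun k _ => maxFace_simplex_subset_iff _ _ _

open Classical in
/-- The (Loday) associahedron `a_ℓ = ∑_{i ≤ j} Δ_{[i, j]}` of a linear order `ℓ` on `I`
(a Minkowski sum). -/
def loday (ℓ : LinearOrder I) : Set (I → ℝ) :=
  ∑ p ∈ (Finset.univ : Finset (I × I)).filter (fun p => ℓ.le p.1 p.2),
    simplex {k | ℓ.le p.1 k ∧ ℓ.le k p.2}

theorem isPolytope_loday (ℓ : LinearOrder I) : IsPolytope (loday ℓ) := by
  classical
  refine IsPolytope.finset_sum _ _ fun p hp => isPolytope_simplex ⟨p.1, ℓ.le_refl _, ?_⟩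
  simpa using hp

theorem gen_loday (ℓ : LinearOrder I) : Gen (loday ℓ) (intervals ℓ.le) := by
  classical
  have h := gen_loday_aux ((Finset.univ : Finset (I × I)).filter (fun p => ℓ.le p.1 p.2))
    (fun p => {k | ℓ.le p.1 k ∧ ℓ.le k p.2}) (fun p hp => ⟨p.1, ℓ.le_refl _, by simpa using hp⟩)
  have e : ((fun p : I × I => {k | ℓ.le p.1 k ∧ ℓ.le k p.2}) ''
      ((Finset.univ : Finset (I × I)).filter (fun p => ℓ.le p.1 p.2))) = intervals ℓ.le := by
    ext S
    constructor
    · rintro ⟨p, hp, rfl⟩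
      exact ⟨p.1, p.2, by simpa using hp, rfl⟩
    · rintro ⟨i, j, hij, rfl⟩
      exact ⟨(i, j), by simpa using hij, rfl⟩
  rw [← e]
  convert! h

/-- A block of a set partition. -/
abbrev Block (r : Setoid I) (c : Quotient r) : Type := {i : I // Quotient.mk r i = c}

open Classical in
/-- The product `a_{ℓ_1} × ⋯ × a_{ℓ_k}` of associahedra, for a set partition of `I`
and linear orders on its blocks. -/
def lodayProd (r : Setoid I) (ℓ : ∀ c : Quotient r, LinearOrder (Block r c)) : Set (I → ℝ) :=
  {x | ∀ c : Quotient r, (fun i : Block r c => x i.1) ∈ loday (ℓ c)}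

open Classical in
/-- Extension by zero from a block. -/
def extBlock (r : Setoid I) (c : Quotient r) : (Block r c → ℝ) →ₗ[ℝ] (I → ℝ) where
  toFun x i := if h : Quotient.mk r i = c then x ⟨i, h⟩ else 0
  map_add' x y := by ext i; by_cases h : Quotient.mk r i = c <;> simp [h]
  map_smul' a x := by ext i; by_cases h : Quotient.mk r i = c <;> simp [h]

open Classical in
theorem dot_extBlock (r : Setoid I) (c : Quotient r) (y : I → ℝ) (x : Block r c → ℝ) :
    y ⬝ᵥ extBlock r c x = (fun i : Block r c => y i.1) ⬝ᵥ x := by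
  simp only [dotProduct, extBlock, LinearMap.coe_mk, AddHom.coe_mk]
  rw [← Finset.sum_subset (Finset.subset_univ (Finset.univ.filter fun i => Quotient.mk r i = c)),
    Finset.sum_subtype (p := fun i => Quotient.mk r i = c) _ (by simp)]
  · exact Finset.sum_congr rfl fun i _ => by rw [dif_pos i.2]
  · intro i _ hi
    have : ¬ Quotient.mk r i = c := by simpa using hi
    rw [dif_neg this, mul_zero]

open Classical in
theorem lodayProd_eq_sum (r : Setoid I) (ℓ : ∀ c : Quotient r, LinearOrder (Block r c)) :
    lodayProd r ℓ = ∑ c : Quotient r, extBlock r c '' loday (ℓ c) := by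
  have hsum : ∀ (g : ∀ c : Quotient r, Block r c → ℝ) (i : I),
      (∑ c : Quotient r, extBlock r c (g c)) i = g (Quotient.mk r i) ⟨i, rfl⟩ := by
    intro g i
    rw [Finset.sum_apply, Finset.sum_eq_single (Quotient.mk r i)]
    · simp [extBlock]
    · intro c _ hc
      simp [extBlock, hc.symm]
    · intro h; exact absurd (Finset.mem_univ _) h
  ext x
  rw [Set.mem_fintype_sum]
  constructor
  · intro hx
    refine ⟨fun c => extBlock r c (fun i => x i.1), fun c => ⟨_, hx c, rfl⟩, ?_⟩
    ext i
    rw [hsum (fun c i => x i.1)]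
  · rintro ⟨g, hg, rfl⟩ c
    choose z hz hzg using hg
    have : (∑ c, g c) = ∑ c, extBlock r c (z c) := Finset.sum_congr rfl fun c _ => (hzg c).symm
    rw [this]
    convert hz c using 1
    ext ⟨i, hi⟩
    subst hi
    exact hsum z i

open Classical in
theorem isPolytope_lodayProd (r : Setoid I) (ℓ : ∀ c : Quotient r, LinearOrder (Block r c)) :
    IsPolytope (lodayProd r ℓ) := by
  rw [lodayProd_eq_sum]
  exact IsPolytope.finset_sum _ _ fun c _ => (isPolytope_loday (ℓ c)).image _

/-- The partial order on `I` whose comparability classes are the blocks, ordered by `ℓ`. -/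
def blockLE (r : Setoid I) (ℓ : ∀ c : Quotient r, LinearOrder (Block r c)) (i j : I) : Prop :=
  ∃ h : Quotient.mk r i = Quotient.mk r j, (ℓ (Quotient.mk r j)).le ⟨i, h⟩ ⟨j, rfl⟩

theorem argmax_image_subset_iff {I J : Type} [Fintype I] [Fintype J] {f : I → J}
    (S : Set I) (y y' : J → ℝ) :
    argmax (f '' S) y ⊆ argmax (f '' S) y' ↔ argmax S (y ∘ f) ⊆ argmax S (y' ∘ f) := by
  have key : ∀ z : J → ℝ, argmax (f '' S) z = f '' argmax S (z ∘ f) := by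
    intro z
    ext j
    constructor
    · rintro ⟨⟨i, hi, rfl⟩, h⟩
      exact ⟨i, ⟨hi, fun k hk => h _ ⟨k, hk, rfl⟩⟩, rfl⟩
    · rintro ⟨i, ⟨hi, h⟩, rfl⟩
      refine ⟨⟨i, hi, rfl⟩, ?_⟩
      rintro _ ⟨k, hk, rfl⟩
      exact h k hk
  rw [key, key]
  constructor
  · rintro h i hi
    obtain ⟨i', ⟨hi', hmax⟩, he⟩ := h ⟨i, hi, rfl⟩
    refine ⟨hi.1, fun k hk => ?_⟩
    have := hmax k hk
    simp only [Function.comp_apply] at this ⊢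
    rwa [he] at this
  · exact fun h => Set.image_mono h

theorem gen_lodayProd (r : Setoid I) (ℓ : ∀ c : Quotient r, LinearOrder (Block r c)) :
    Gen (lodayProd r ℓ) (intervals (blockLE r ℓ)) := by
  classical
  intro y y'
  rw [lodayProd_eq_sum, maxFace_sum_subset_iff _ _ fun c _ => (isPolytope_loday (ℓ c)).image _]
  have h1 : ∀ c : Quotient r,
      (AssocWitt.maxFace (extBlock r c '' loday (ℓ c)) y ⊆
        AssocWitt.maxFace (extBlock r c '' loday (ℓ c)) y') ↔
      ∀ S ∈ intervals (ℓ c).le, argmax (Subtype.val '' S) y ⊆ argmax (Subtype.val '' S) y' := by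
    intro c
    rw [maxFace_image_subset_iff (extBlock r c) (fun y => fun i : Block r c => y i.1)
      (dot_extBlock r c), gen_loday (ℓ c)]
    exact forall₂_congr fun S _ => (argmax_image_subset_iff (f := Subtype.val) S y y').symm
  have h2 : ∀ (c : Quotient r) (a b : Block r c), (ℓ c).le a b →
      Subtype.val '' {k : Block r c | (ℓ c).le a k ∧ (ℓ c).le k b} =
        {k | blockLE r ℓ a.1 k ∧ blockLE r ℓ k b.1} := by
    rintro c ⟨a, ha⟩ ⟨b, hb⟩ hab
    subst hb
    ext k
    constructor
    · rintro ⟨⟨k, hk⟩, ⟨h1, h2⟩, rfl⟩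
      refine ⟨⟨ha.trans hk.symm, ?_⟩, ⟨hk, h2⟩⟩
      have : ∀ (d : Quotient r) (hd : Quotient.mk r k = d) (ha' : Quotient.mk r a = d),
          (ℓ d).le ⟨a, ha'⟩ ⟨k, hd⟩ →
          (ℓ (Quotient.mk r k)).le ⟨a, ha'.trans hd.symm⟩ ⟨k, rfl⟩ := by
        intro d hd ha' h; subst hd; exact h
      exact this _ hk ha h1
    · rintro ⟨⟨e1, h1⟩, ⟨e2, h2⟩⟩
      refine ⟨⟨k, e2⟩, ⟨?_, h2⟩, rfl⟩
      have : ∀ (d : Quotient r) (hd : Quotient.mk r k = d) (ha' : Quotient.mk r a = d),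
          (ℓ (Quotient.mk r k)).le ⟨a, ha'.trans hd.symm⟩ ⟨k, rfl⟩ →
          (ℓ d).le ⟨a, ha'⟩ ⟨k, hd⟩ := by
        intro d hd ha' h; subst hd; exact h
      exact this _ e2 ha h1
  constructor
  · rintro h S ⟨i, j, ⟨e, hij⟩, rfl⟩
    have := (h1 (Quotient.mk r j)).1 (h _ (Finset.mem_univ _)) _ ⟨⟨i, e⟩, ⟨j, rfl⟩, hij, rfl⟩
    rwa [h2 _ _ _ hij] at this
  · rintro h c -
    rw [h1]
    rintro S ⟨a, b, hab, rfl⟩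
    rw [h2 _ _ _ hab]
    refine h _ ⟨a.1, b.1, ?_, rfl⟩
    obtain ⟨b, hb⟩ := b
    subst hb
    exact ⟨a.2, hab⟩

/-- A partial order all of whose comparability classes are chains. -/
structure IsChainOrder (ρ : I → I → Prop) : Prop where
  refl : ∀ i, ρ i i
  trans : ∀ i j k, ρ i j → ρ j k → ρ i k
  antisymm : ∀ i j, ρ i j → ρ j i → i = j
  up : ∀ i j k, ρ i j → ρ i k → ρ j k ∨ ρ k j
  down : ∀ i j k, ρ j i → ρ k i → ρ j k ∨ ρ k j

theorem isChainOrder_blockLE (r : Setoid I) (ℓ : ∀ c : Quotient r, LinearOrder (Block r c)) :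
    IsChainOrder (blockLE r ℓ) := by
  have key : ∀ (c : Quotient r) (i j : I) (hi : Quotient.mk r i = c) (hj : Quotient.mk r j = c),
      blockLE r ℓ i j ↔ (ℓ c).le ⟨i, hi⟩ ⟨j, hj⟩ := by
    intro c i j hi hj
    subst hj
    exact ⟨fun ⟨_, h⟩ => h, fun h => ⟨hi, h⟩⟩
  constructor
  · intro i; exact ⟨rfl, (ℓ _).le_refl _⟩
  · intro i j k h1 h2
    have e1 := h1.1
    have e2 := h2.1
    rw [key _ i j (e1.trans e2) e2] at h1
    rw [key _ j k e2 rfl] at h2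
    rw [key _ i k (e1.trans e2) rfl]
    exact (ℓ _).le_trans _ _ _ h1 h2
  · intro i j h1 h2
    have e := h1.1
    rw [key _ i j e rfl] at h1
    rw [key _ j i rfl e] at h2
    exact congrArg Subtype.val ((ℓ _).le_antisymm _ _ h1 h2)
  · intro i j k h1 h2
    have e : Quotient.mk r j = Quotient.mk r k := h1.1.symm.trans h2.1
    rw [key _ j k e rfl, key _ k j rfl e]
    exact (ℓ _).le_total _ _
  · intro i j k h1 h2
    have e : Quotient.mk r j = Quotient.mk r k := h1.1.trans h2.1.symm
    rw [key _ j k e rfl, key _ k j rfl e]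
    exact (ℓ _).le_total _ _

theorem IsChainOrder.exists_blockLE {ρ : I → I → Prop} (h : IsChainOrder ρ) :
    ∃ (r : Setoid I) (ℓ : ∀ c : Quotient r, LinearOrder (Block r c)), blockLE r ℓ = ρ := by
  classical
  let r : Setoid I :=
    { r := fun i j => ρ i j ∨ ρ j i
      iseqv := by
        refine ⟨fun i => Or.inl (h.refl i), fun h => h.symm, ?_⟩
        rintro i j k (h1 | h1) (h2 | h2)
        · exact Or.inl (h.trans _ _ _ h1 h2)
        · exact h.down _ _ _ h1 h2
        · exact h.up _ _ _ h1 h2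
        · exact Or.inr (h.trans _ _ _ h2 h1) }
  refine ⟨r, fun c =>
    { le := fun a b => ρ a.1 b.1
      le_refl := fun a => h.refl _
      le_trans := fun a b c => h.trans _ _ _
      le_antisymm := fun a b h1 h2 => Subtype.ext (h.antisymm _ _ h1 h2)
      le_total := fun a b => by
        have : Quotient.mk r a.1 = Quotient.mk r b.1 := a.2.trans b.2.symm
        exact Quotient.exact this
      toDecidableLE := fun _ _ => Classical.propDecidable _ }, ?_⟩
  ext i j
  exact ⟨fun ⟨_, h⟩ => h, fun h => ⟨Quotient.sound (Or.inl h), h⟩⟩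

/-! ### Normal equivalence classes of polytopes -/

/-- The type of polytopes in `ℝ I`. -/
def Polytope (I : Type) : Type := {P : Set (I → ℝ) // IsPolytope P}

/-- Normal equivalence: two polytopes are equivalent when they have the same normal fan. -/
instance normalEquiv (I : Type) [Fintype I] : Setoid (Polytope I) :=
  Setoid.comap (fun P => normalFan P.1) ⊥

theorem normalEquiv_iff {P Q : Polytope I} : P ≈ Q ↔ normalFan P.1 = normalFan Q.1 := Iff.rfl

/-- Normal equivalence classes of polytopes in `ℝ I`. -/
def PolyClass (I : Type) [Fintype I] : Type := Quotient (normalEquiv I)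

namespace Polytope

/-- Relabelling of coordinates along a bijection `σ : I ≃ J`. -/
def relabel (σ : I ≃ J) (P : Polytope I) : Polytope J :=
  ⟨LinearMap.funLeft ℝ ℝ σ.symm '' P.1, P.2.image _⟩

/-- Extension by zero `ℝ I → ℝ (I ⊕ J)`. -/
def extL (I J : Type) : (I → ℝ) →ₗ[ℝ] (I ⊕ J → ℝ) where
  toFun x := Sum.elim x 0
  map_add' x y := by ext (i | j) <;> simp
  map_smul' a x := by ext (i | j) <;> simp

/-- Extension by zero `ℝ J → ℝ (I ⊕ J)`. -/
def extR (I J : Type) : (J → ℝ) →ₗ[ℝ] (I ⊕ J → ℝ) where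
  toFun x := Sum.elim 0 x
  map_add' x y := by ext (i | j) <;> simp
  map_smul' a x := by ext (i | j) <;> simp

theorem prod_eq_add (P : Set (I → ℝ)) (Q : Set (J → ℝ)) :
    {x : I ⊕ J → ℝ | x ∘ Sum.inl ∈ P ∧ x ∘ Sum.inr ∈ Q} = extL I J '' P + extR I J '' Q := by
  ext x
  constructor
  · rintro ⟨h1, h2⟩
    refine ⟨_, ⟨_, h1, rfl⟩, _, ⟨_, h2, rfl⟩, ?_⟩
    ext (i | j) <;> simp [extL, extR]
  · rintro ⟨_, ⟨p, hp, rfl⟩, _, ⟨q, hq, rfl⟩, rfl⟩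
    constructor
    · convert! hp using 1; ext i; simp [extL, extR]
    · convert! hq using 1; ext i; simp [extL, extR]

/-- The cartesian product `P × Q ⊆ ℝ (I ⊔ J)`. -/
def prod (P : Polytope I) (Q : Polytope J) : Polytope (I ⊕ J) :=
  ⟨{x | x ∘ Sum.inl ∈ P.1 ∧ x ∘ Sum.inr ∈ Q.1}, by
    rw [prod_eq_add]; exact (P.2.image _).add (Q.2.image _)⟩

/-- The indicator functional `𝟙_S` of the first part `S` of a decomposition `S ⊔ T`. -/
def indL (I J : Type) : I ⊕ J → ℝ := Sum.elim 1 0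

/-- The first factor `P|_S` of the `𝟙_S`-maximal face `P|_S × P/_S` of `P ⊆ ℝ (S ⊔ T)`. -/
def restrict (P : Polytope (I ⊕ J)) : Polytope I :=
  ⟨LinearMap.funLeft ℝ ℝ Sum.inl '' maxFace P.1 (indL I J), (P.2.maxFace _).image _⟩

/-- The second factor `P/_S` of the `𝟙_S`-maximal face `P|_S × P/_S` of `P ⊆ ℝ (S ⊔ T)`. -/
def contract (P : Polytope (I ⊕ J)) : Polytope J :=
  ⟨LinearMap.funLeft ℝ ℝ Sum.inr '' maxFace P.1 (indL I J), (P.2.maxFace _).image _⟩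

theorem dot_funLeft_symm (σ : I ≃ J) (y : J → ℝ) (x : I → ℝ) :
    y ⬝ᵥ LinearMap.funLeft ℝ ℝ σ.symm x = (y ∘ σ) ⬝ᵥ x := by
  simp only [dotProduct, LinearMap.funLeft_apply, Function.comp_apply]
  exact (Fintype.sum_equiv σ _ _ fun i => by simp).symm

theorem dot_extL (y : I ⊕ J → ℝ) (x : I → ℝ) : y ⬝ᵥ extL I J x = (y ∘ Sum.inl) ⬝ᵥ x := by
  simp [dotProduct, extL]

theorem dot_extR (y : I ⊕ J → ℝ) (x : J → ℝ) : y ⬝ᵥ extR I J x = (y ∘ Sum.inr) ⬝ᵥ x := by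
  simp [dotProduct, extR]

theorem dot_funLeft_inl (y : I → ℝ) (x : I ⊕ J → ℝ) :
    y ⬝ᵥ LinearMap.funLeft ℝ ℝ Sum.inl x = (Sum.elim y 0) ⬝ᵥ x := by
  simp [dotProduct, LinearMap.funLeft_apply]

theorem dot_funLeft_inr (y : J → ℝ) (x : I ⊕ J → ℝ) :
    y ⬝ᵥ LinearMap.funLeft ℝ ℝ Sum.inr x = (Sum.elim 0 y) ⬝ᵥ x := by
  simp [dotProduct, LinearMap.funLeft_apply]

theorem relabel_congr (σ : I ≃ J) {P Q : Polytope I} (h : P ≈ Q) : relabel σ P ≈ relabel σ Q := by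
  rw [normalEquiv_iff, normalFan_eq_iff] at h ⊢
  intro y y'
  simp only [relabel]
  rw [maxFace_image_subset_iff _ _ (dot_funLeft_symm σ),
    maxFace_image_subset_iff _ _ (dot_funLeft_symm σ)]
  exact h _ _

theorem maxFace_prod_subset_iff (P : Polytope I) (Q : Polytope J) (y y' : I ⊕ J → ℝ) :
    maxFace (prod P Q).1 y ⊆ maxFace (prod P Q).1 y' ↔
      maxFace P.1 (y ∘ Sum.inl) ⊆ maxFace P.1 (y' ∘ Sum.inl) ∧
      maxFace Q.1 (y ∘ Sum.inr) ⊆ maxFace Q.1 (y' ∘ Sum.inr) := by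
  simp only [prod]
  rw [prod_eq_add, maxFace_add_subset_iff (P.2.image _) (Q.2.image _),
    maxFace_image_subset_iff _ _ dot_extL, maxFace_image_subset_iff _ _ dot_extR]

theorem prod_congr {P P' : Polytope I} {Q Q' : Polytope J} (h1 : P ≈ P') (h2 : Q ≈ Q') :
    prod P Q ≈ prod P' Q' := by
  rw [normalEquiv_iff, normalFan_eq_iff] at *
  intro y y'
  rw [maxFace_prod_subset_iff, maxFace_prod_subset_iff, h1, h2]

theorem maxFace_maxFace_congr {P Q : Polytope I} (h : P ≈ Q) (u y y' : I → ℝ) :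
    (maxFace (maxFace P.1 u) y ⊆ maxFace (maxFace P.1 u) y') ↔
      (maxFace (maxFace Q.1 u) y ⊆ maxFace (maxFace Q.1 u) y') := by
  rw [normalEquiv_iff, normalFan_eq_iff] at h
  obtain ⟨ε, h1, h2, h3, h4⟩ := ((P.2.eventually_maxFace u y).and
    ((P.2.eventually_maxFace u y').and ((Q.2.eventually_maxFace u y).and
      (Q.2.eventually_maxFace u y')))).exists
  rw [← h1, ← h2, ← h3, ← h4]
  exact h _ _

theorem restrict_congr {P Q : Polytope (I ⊕ J)} (h : P ≈ Q) : restrict P ≈ restrict Q := by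
  rw [normalEquiv_iff, normalFan_eq_iff]
  intro y y'
  simp only [restrict]
  rw [maxFace_image_subset_iff _ _ dot_funLeft_inl, maxFace_image_subset_iff _ _ dot_funLeft_inl]
  exact maxFace_maxFace_congr h _ _ _

theorem contract_congr {P Q : Polytope (I ⊕ J)} (h : P ≈ Q) : contract P ≈ contract Q := by
  rw [normalEquiv_iff, normalFan_eq_iff]
  intro y y'
  simp only [contract]
  rw [maxFace_image_subset_iff _ _ dot_funLeft_inr, maxFace_image_subset_iff _ _ dot_funLeft_inr]
  exact maxFace_maxFace_congr h _ _ _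

end Polytope

namespace PolyClass

/-- Relabelling of normal equivalence classes. -/
def relabel (σ : I ≃ J) : PolyClass I → PolyClass J :=
  Quotient.map (Polytope.relabel σ) fun _ _ h => Polytope.relabel_congr σ h

/-- The product of normal equivalence classes. -/
def prod : PolyClass I → PolyClass J → PolyClass (I ⊕ J) :=
  Quotient.map₂ Polytope.prod fun _ _ h1 _ _ h2 => Polytope.prod_congr h1 h2

/-- `P ↦ P|_S` on normal equivalence classes. -/
def restrict : PolyClass (I ⊕ J) → PolyClass I :=
  Quotient.map Polytope.restrict fun _ _ h => Polytope.restrict_congr h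

/-- `P ↦ P/_S` on normal equivalence classes. -/
def contract : PolyClass (I ⊕ J) → PolyClass J :=
  Quotient.map Polytope.contract fun _ _ h => Polytope.contract_congr h

end PolyClass

/-- The normal equivalence class of the associahedron `a_ℓ`. -/
def lodayClass (ℓ : LinearOrder I) : PolyClass I := ⟦⟨loday ℓ, isPolytope_loday ℓ⟩⟧

/-- The normal equivalence class of the product `a_{ℓ_1} × ⋯ × a_{ℓ_k}`. -/
def lodayProdClass (r : Setoid I) (ℓ : ∀ c : Quotient r, LinearOrder (Block r c)) : PolyClass I :=
  ⟦⟨lodayProd r ℓ, isPolytope_lodayProd r ℓ⟩⟧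

/-- `c` is the normal equivalence class of a product of associahedra. -/
def IsAssocProd (c : PolyClass I) : Prop := ∃ r ℓ, c = lodayProdClass r ℓ

/-- `c` is the normal equivalence class of a single associahedron. -/
def IsAssoc (c : PolyClass I) : Prop := ∃ ℓ, c = lodayClass ℓ

theorem isAssocProd_mk_iff {P : Polytope I} : IsAssocProd (⟦P⟧ : PolyClass I) ↔
    ∃ ρ, IsChainOrder ρ ∧ Gen P.1 (intervals ρ) := by
  constructor
  · rintro ⟨r, ℓ, h⟩
    have h : P ≈ _ := Quotient.exact h
    exact ⟨_, isChainOrder_blockLE r ℓ, (gen_lodayProd r ℓ).of_normalFan_eq h.symm⟩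
  · rintro ⟨ρ, hρ, h⟩
    obtain ⟨r, ℓ, rfl⟩ := hρ.exists_blockLE
    exact ⟨r, ℓ, Quotient.sound (h.normalFan_eq (gen_lodayProd r ℓ))⟩

theorem isAssoc_mk_iff {P : Polytope I} : IsAssoc (⟦P⟧ : PolyClass I) ↔
    ∃ ρ, (IsChainOrder ρ ∧ ∀ i j, ρ i j ∨ ρ j i) ∧ Gen P.1 (intervals ρ) := by
  classical
  constructor
  · rintro ⟨ℓ, h⟩
    have h : P ≈ _ := Quotient.exact h
    exact ⟨ℓ.le, ⟨⟨ℓ.le_refl, ℓ.le_trans, ℓ.le_antisymm, fun _ _ _ _ _ => ℓ.le_total _ _,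
      fun _ _ _ _ _ => ℓ.le_total _ _⟩, ℓ.le_total⟩, (gen_loday ℓ).of_normalFan_eq h.symm⟩
  · rintro ⟨ρ, ⟨hρ, ht⟩, h⟩
    exact ⟨{ le := ρ, le_refl := hρ.refl, le_trans := hρ.trans, le_antisymm := hρ.antisymm,
             le_total := ht, toDecidableLE := fun _ _ => Classical.propDecidable _ },
      Quotient.sound (h.normalFan_eq (gen_loday _))⟩

theorem gen_relabel (σ : I ≃ J) {P : Polytope I} {ρ : I → I → Prop}
    (h : Gen P.1 (intervals ρ)) :
    Gen (Polytope.relabel σ P).1 (intervals fun a b => ρ (σ.symm a) (σ.symm b)) := by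
  intro y y'
  simp only [Polytope.relabel]
  rw [maxFace_image_subset_iff _ _ (Polytope.dot_funLeft_symm σ), h]
  have e : ∀ i j, σ '' {k | ρ i k ∧ ρ k j} = {k | ρ i (σ.symm k) ∧ ρ (σ.symm k) j} := by
    intro i j
    ext k
    constructor
    · rintro ⟨k, hk, rfl⟩; simpa using hk
    · intro hk; exact ⟨σ.symm k, hk, by simp⟩
  constructor
  · rintro h _ ⟨a, b, hab, rfl⟩
    rw [← e, argmax_image_subset_iff]
    exact h _ ⟨_, _, hab, rfl⟩
  · rintro h _ ⟨i, j, hij, rfl⟩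
    have := h {k | ρ i (σ.symm k) ∧ ρ (σ.symm k) j} ⟨σ i, σ j, by simpa using hij, by simp⟩
    rwa [← e, argmax_image_subset_iff] at this

theorem IsChainOrder.relabel (σ : I ≃ J) {ρ : I → I → Prop} (h : IsChainOrder ρ) :
    IsChainOrder fun a b => ρ (σ.symm a) (σ.symm b) :=
  ⟨fun _ => h.refl _, fun _ _ _ => h.trans _ _ _,
    fun _ _ h1 h2 => σ.symm.injective (h.antisymm _ _ h1 h2),
    fun _ _ _ => h.up _ _ _, fun _ _ _ => h.down _ _ _⟩

theorem IsAssocProd.relabel (σ : I ≃ J) {c : PolyClass I} (h : IsAssocProd c) :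
    IsAssocProd (c.relabel σ) := by
  induction c using Quotient.ind with | _ P
  obtain ⟨ρ, hρ, h⟩ := isAssocProd_mk_iff.1 h
  exact isAssocProd_mk_iff.2 ⟨_, hρ.relabel σ, gen_relabel σ h⟩

theorem IsAssoc.relabel (σ : I ≃ J) {c : PolyClass I} (h : IsAssoc c) :
    IsAssoc (c.relabel σ) := by
  induction c using Quotient.ind with | _ P
  obtain ⟨ρ, ⟨hρ, ht⟩, h⟩ := isAssoc_mk_iff.1 h
  exact isAssoc_mk_iff.2 ⟨_, ⟨hρ.relabel σ, fun _ _ => ht _ _⟩, gen_relabel σ h⟩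

theorem IsAssocProd.prod {c : PolyClass I} {d : PolyClass J} (hc : IsAssocProd c)
    (hd : IsAssocProd d) : IsAssocProd (c.prod d) := by
  induction c using Quotient.ind with | _ P
  induction d using Quotient.ind with | _ Q
  obtain ⟨ρ, hρ, hP⟩ := isAssocProd_mk_iff.1 hc
  obtain ⟨τ, hτ, hQ⟩ := isAssocProd_mk_iff.1 hd
  refine isAssocProd_mk_iff.2 ⟨Sum.LiftRel ρ τ, ⟨?_, ?_, ?_, ?_, ?_⟩, ?_⟩
  · rintro (i | i)
    · exact .inl (hρ.refl i)
    · exact .inr (hτ.refl i)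
  · rintro _ _ _ (⟨h1⟩ | ⟨h1⟩) (⟨h2⟩ | ⟨h2⟩)
    · exact .inl (hρ.trans _ _ _ h1 h2)
    · exact .inr (hτ.trans _ _ _ h1 h2)
  · rintro _ _ (⟨h1⟩ | ⟨h1⟩) (⟨h2⟩ | ⟨h2⟩)
    · exact congrArg _ (hρ.antisymm _ _ h1 h2)
    · exact congrArg _ (hτ.antisymm _ _ h1 h2)
  · rintro _ _ _ (⟨h1⟩ | ⟨h1⟩) (⟨h2⟩ | ⟨h2⟩)
    · exact (hρ.up _ _ _ h1 h2).imp .inl .inl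
    · exact (hτ.up _ _ _ h1 h2).imp .inr .inr
  · rintro _ _ _ (⟨h1⟩ | ⟨h1⟩) (⟨h2⟩ | ⟨h2⟩)
    · exact (hρ.down _ _ _ h1 h2).imp .inl .inl
    · exact (hτ.down _ _ _ h1 h2).imp .inr .inr
  · intro y y'
    rw [Polytope.maxFace_prod_subset_iff, hP, hQ]
    have eL : ∀ i j, {k | Sum.LiftRel ρ τ (.inl i) k ∧ Sum.LiftRel ρ τ k (.inl j)} =
        Sum.inl '' {k | ρ i k ∧ ρ k j} := by
      intro i j; ext (k | k) <;> simp
    have eR : ∀ i j, {k | Sum.LiftRel ρ τ (.inr i) k ∧ Sum.LiftRel ρ τ k (.inr j)} =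
        Sum.inr '' {k | τ i k ∧ τ k j} := by
      intro i j; ext (k | k) <;> simp
    constructor
    · rintro ⟨h1, h2⟩ _ ⟨_, _, ⟨hij⟩ | ⟨hij⟩, rfl⟩
      · rw [eL, argmax_image_subset_iff]; exact h1 _ ⟨_, _, hij, rfl⟩
      · rw [eR, argmax_image_subset_iff]; exact h2 _ ⟨_, _, hij, rfl⟩
    · intro h
      constructor
      · rintro _ ⟨i, j, hij, rfl⟩
        rw [← argmax_image_subset_iff, ← eL]
        exact h _ ⟨_, _, .inl hij, rfl⟩
      · rintro _ ⟨i, j, hij, rfl⟩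
        rw [← argmax_image_subset_iff, ← eR]
        exact h _ ⟨_, _, .inr hij, rfl⟩

theorem argmax_elim_left (S : Set (I ⊕ J)) (y y' : I → ℝ) :
    argmax (argmax S (Polytope.indL I J)) (Sum.elim y 0) ⊆
      argmax (argmax S (Polytope.indL I J)) (Sum.elim y' 0) ↔
    argmax (Sum.inl ⁻¹' S) y ⊆ argmax (Sum.inl ⁻¹' S) y' := by
  by_cases hS : ∃ i, Sum.inl i ∈ S
  · have e : argmax S (Polytope.indL I J) = Sum.inl '' (Sum.inl ⁻¹' S) := by
      obtain ⟨i, hi⟩ := hS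
      ext (k | k)
      · constructor
        · rintro ⟨h, -⟩; exact ⟨k, h, rfl⟩
        · rintro ⟨k', h, hk⟩
          cases hk
          refine ⟨h, ?_⟩
          rintro (j | j) - <;> simp [Polytope.indL]
      · constructor
        · rintro ⟨-, h⟩
          have := h _ hi
          simp [Polytope.indL] at this
          linarith
        · rintro ⟨_, _, h⟩; cases h
    rw [e, argmax_image_subset_iff]
    rfl
  · push Not at hS
    have e : Sum.inl ⁻¹' S = (∅ : Set I) := by
      ext i; simpa using hS i
    rw [e]
    constructor
    · rintro - i ⟨h, -⟩; exact absurd h (Set.notMem_empty i)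
    · rintro - (k | k) ⟨hk, -⟩
      · exact absurd hk.1 (hS k)
      · refine ⟨hk, ?_⟩
        rintro (j | j) hj
        · exact absurd hj.1 (hS j)
        · simp

theorem argmax_elim_right (S : Set (I ⊕ J)) (y y' : J → ℝ) :
    argmax (argmax S (Polytope.indL I J)) (Sum.elim 0 y) ⊆
      argmax (argmax S (Polytope.indL I J)) (Sum.elim 0 y') ↔
    (Sum.inl ⁻¹' S = (∅ : Set I) →
      argmax (Sum.inr ⁻¹' S) y ⊆ argmax (Sum.inr ⁻¹' S) y') := by
  by_cases hS : ∃ i, Sum.inl i ∈ S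
  · obtain ⟨i, hi⟩ := hS
    constructor
    · intro _ h
      have : i ∈ (Sum.inl ⁻¹' S : Set I) := hi
      rw [h] at this
      exact absurd this (Set.notMem_empty i)
    · rintro - (k | k) ⟨hk, -⟩
      · refine ⟨hk, ?_⟩
        rintro (j | j) hj
        · simp
        · have := hj.2 _ hi
          simp [Polytope.indL] at this
          linarith
      · have := hk.2 _ hi
        simp [Polytope.indL] at this
        linarith
  · push Not at hS
    have e : Sum.inl ⁻¹' S = (∅ : Set I) := by
      ext i; simpa using hS i
    have e' : argmax S (Polytope.indL I J) = Sum.inr '' (Sum.inr ⁻¹' S) := by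
      ext (k | k)
      · constructor
        · rintro ⟨h, -⟩; exact absurd h (hS k)
        · rintro ⟨_, _, h⟩; cases h
      · constructor
        · rintro ⟨h, -⟩; exact ⟨k, h, rfl⟩
        · rintro ⟨k', h, hk⟩
          cases hk
          refine ⟨h, ?_⟩
          rintro (j | j) hj
          · exact absurd hj (hS j)
          · simp [Polytope.indL]
    rw [e', argmax_image_subset_iff, e]
    simp only [true_imp_iff]
    rfl

theorem intervals_nonempty {ρ : I → I → Prop} (hρ : IsChainOrder ρ) :
    ∀ S ∈ intervals ρ, S.Nonempty := by
  rintro _ ⟨i, j, hij, rfl⟩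
  exact ⟨i, hρ.refl i, hij⟩

theorem exists_least {ρ : I → I → Prop} (hρ : IsChainOrder ρ) (S : Set I) (hn : S.Nonempty)
    (hc : ∀ i ∈ S, ∀ j ∈ S, ρ i j ∨ ρ j i) : ∃ i ∈ S, ∀ j ∈ S, ρ i j := by
  classical
  let _ : PartialOrder I :=
    { le := ρ, le_refl := hρ.refl, le_trans := hρ.trans, le_antisymm := hρ.antisymm }
  obtain ⟨i, hi⟩ := (Set.toFinite S).exists_minimal hn
  refine ⟨i, hi.prop, fun j hj => ?_⟩
  rcases hc i hi.prop j hj with h | h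
  · exact h
  · exact hi.le_of_le hj h

theorem IsAssocProd.restrict {c : PolyClass (I ⊕ J)} (hc : IsAssocProd c) :
    IsAssocProd c.restrict := by
  induction c using Quotient.ind with | _ P
  obtain ⟨ρ, hρ, hP⟩ := isAssocProd_mk_iff.1 hc
  refine isAssocProd_mk_iff.2 ⟨fun a b => ρ (.inl a) (.inl b), ⟨fun _ => hρ.refl _,
    fun _ _ _ => hρ.trans _ _ _, fun _ _ h1 h2 => Sum.inl_injective (hρ.antisymm _ _ h1 h2),
    fun _ _ _ => hρ.up _ _ _, fun _ _ _ => hρ.down _ _ _⟩, ?_⟩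
  intro y y'
  simp only [Polytope.restrict]
  rw [maxFace_image_subset_iff _ _ Polytope.dot_funLeft_inl,
    hP.maxFace P.2 (intervals_nonempty hρ), Set.forall_mem_image]
  simp only [argmax_elim_left]
  constructor
  · rintro h _ ⟨i, j, hij, rfl⟩
    exact h (x := {k | ρ (.inl i) k ∧ ρ k (.inl j)}) ⟨_, _, hij, rfl⟩
  · rintro h _ ⟨i, j, hij, rfl⟩
    by_cases hn : (Sum.inl ⁻¹' {k | ρ i k ∧ ρ k j} : Set I).Nonempty
    · have hρ' : IsChainOrder fun a b : I => ρ (.inl a) (.inl b) := ⟨fun _ => hρ.refl _,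
        fun _ _ _ => hρ.trans _ _ _, fun _ _ h1 h2 => Sum.inl_injective (hρ.antisymm _ _ h1 h2),
        fun _ _ _ => hρ.up _ _ _, fun _ _ _ => hρ.down _ _ _⟩
      have hρ'' : IsChainOrder fun a b : I => ρ (.inl b) (.inl a) := ⟨fun _ => hρ.refl _,
        fun _ _ _ h1 h2 => hρ.trans _ _ _ h2 h1,
        fun _ _ h1 h2 => Sum.inl_injective (hρ.antisymm _ _ h2 h1),
        fun _ _ _ h1 h2 => (hρ.down _ _ _ h1 h2).symm,
        fun _ _ _ h1 h2 => (hρ.up _ _ _ h1 h2).symm⟩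
      obtain ⟨a, ha, ha'⟩ := exists_least hρ' _ hn fun p hp q hq => hρ.up _ _ _ hp.1 hq.1
      obtain ⟨b, hb, hb'⟩ := exists_least hρ'' _ hn fun p hp q hq =>
        (hρ.up _ _ _ hp.1 hq.1).symm
      have e : (Sum.inl ⁻¹' {k | ρ i k ∧ ρ k j} : Set I) =
          {k | ρ (.inl a) (.inl k) ∧ ρ (.inl k) (.inl b)} := by
        ext k
        constructor
        · intro hk; exact ⟨ha' k hk, hb' k hk⟩
        · intro hk
          exact ⟨hρ.trans _ _ _ ha.1 hk.1, hρ.trans _ _ _ hk.2 hb.2⟩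
      rw [e]
      exact h _ ⟨a, b, ha' b hb, rfl⟩
    · rw [Set.not_nonempty_iff_eq_empty] at hn
      rw [hn]
      rintro i ⟨h, -⟩; exact absurd h (Set.notMem_empty i)

theorem IsAssocProd.contract {c : PolyClass (I ⊕ J)} (hc : IsAssocProd c) :
    IsAssocProd c.contract := by
  induction c using Quotient.ind with | _ P
  obtain ⟨ρ, hρ, hP⟩ := isAssocProd_mk_iff.1 hc
  have sub : ∀ a b k : J, ρ (.inr a) (.inr k) → ρ (.inr k) (.inr b) →
      (∀ i : I, ¬(ρ (.inr a) (.inl i) ∧ ρ (.inl i) (.inr b))) →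
      (∀ i : I, ¬(ρ (.inr a) (.inl i) ∧ ρ (.inl i) (.inr k))) ∧
      (∀ i : I, ¬(ρ (.inr k) (.inl i) ∧ ρ (.inl i) (.inr b))) := fun a b k h1 h2 h =>
    ⟨fun i hi => h i ⟨hi.1, hρ.trans _ _ _ hi.2 h2⟩,
      fun i hi => h i ⟨hρ.trans _ _ _ h1 hi.1, hi.2⟩⟩
  refine isAssocProd_mk_iff.2 ⟨fun a b => ρ (.inr a) (.inr b) ∧
    ∀ i : I, ¬(ρ (.inr a) (.inl i) ∧ ρ (.inl i) (.inr b)), ⟨?_, ?_, ?_, ?_, ?_⟩, ?_⟩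
  · exact fun a => ⟨hρ.refl _, fun i hi => Sum.inr_ne_inl (hρ.antisymm _ _ hi.1 hi.2)⟩
  · rintro a b c ⟨h1, h1'⟩ ⟨h2, h2'⟩
    refine ⟨hρ.trans _ _ _ h1 h2, fun i hi => ?_⟩
    rcases hρ.up _ _ _ h1 hi.1 with h | h
    · exact h2' i ⟨h, hi.2⟩
    · exact h1' i ⟨hi.1, h⟩
  · exact fun _ _ h1 h2 => Sum.inr_injective (hρ.antisymm _ _ h1.1 h2.1)
  · rintro a b c ⟨h1, h1'⟩ ⟨h2, h2'⟩
    rcases hρ.up _ _ _ h1 h2 with h | h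
    · exact Or.inl ⟨h, (sub _ _ _ h1 h h2').2⟩
    · exact Or.inr ⟨h, (sub _ _ _ h2 h h1').2⟩
  · rintro a b c ⟨h1, h1'⟩ ⟨h2, h2'⟩
    rcases hρ.down _ _ _ h1 h2 with h | h
    · exact Or.inl ⟨h, (sub _ _ _ h h2 h1').1⟩
    · exact Or.inr ⟨h, (sub _ _ _ h h1 h2').1⟩
  · intro y y'
    simp only [Polytope.contract]
    rw [maxFace_image_subset_iff _ _ Polytope.dot_funLeft_inr,
      hP.maxFace P.2 (intervals_nonempty hρ), Set.forall_mem_image]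
    simp only [argmax_elim_right]
    have e : ∀ a b : J, (∀ i : I, ¬(ρ (.inr a) (.inl i) ∧ ρ (.inl i) (.inr b))) →
        {k : J | (ρ (.inr a) (.inr k) ∧ ∀ i : I, ¬(ρ (.inr a) (.inl i) ∧ ρ (.inl i) (.inr k))) ∧
          (ρ (.inr k) (.inr b) ∧ ∀ i : I, ¬(ρ (.inr k) (.inl i) ∧ ρ (.inl i) (.inr b)))} =
        (Sum.inr ⁻¹' {k | ρ (.inr a) k ∧ ρ k (.inr b)}) := by
      intro a b hab
      ext k
      constructor
      · rintro ⟨⟨h1, -⟩, ⟨h2, -⟩⟩; exact ⟨h1, h2⟩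
      · rintro ⟨h1, h2⟩
        have := sub _ _ _ h1 h2 hab
        exact ⟨⟨h1, this.1⟩, ⟨h2, this.2⟩⟩
    constructor
    · rintro h _ ⟨a, b, ⟨hab, hab'⟩, rfl⟩
      rw [e a b hab']
      refine h (x := {k | ρ (.inr a) k ∧ ρ k (.inr b)}) ⟨_, _, hab, rfl⟩ ?_
      ext i
      exact ⟨fun hi => absurd hi (hab' i), fun hi => absurd hi (Set.notMem_empty i)⟩
    · rintro h _ ⟨i, j, hij, rfl⟩ hS
      have hS' : ∀ k : I, ¬(ρ i (.inl k) ∧ ρ (.inl k) j) := by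
        intro k hk
        have : k ∈ (Sum.inl ⁻¹' {k | ρ i k ∧ ρ k j} : Set I) := hk
        rw [hS] at this
        exact Set.notMem_empty k this
      rcases i with i | a
      · exact absurd ⟨hρ.refl _, hij⟩ (hS' i)
      rcases j with j | b
      · exact absurd ⟨hij, hρ.refl _⟩ (hS' j)
      rw [← e a b hS']
      exact h _ ⟨a, b, ⟨hij, hS'⟩, rfl⟩

theorem PolyClass.relabel_trans {L : Type} [Fintype L] (σ : I ≃ J) (τ : J ≃ L) (c : PolyClass I) :
    (c.relabel σ).relabel τ = c.relabel (σ.trans τ) := by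
  induction c using Quotient.ind with | _ P
  refine congrArg (Quotient.mk _) (Subtype.ext ?_)
  simp only [Polytope.relabel, Set.image_image]
  rfl

theorem PolyClass.relabel_refl (c : PolyClass I) : c.relabel (Equiv.refl I) = c := by
  induction c using Quotient.ind with | _ P
  refine congrArg (Quotient.mk _) (Subtype.ext ?_)
  change (fun x => x) '' P.1 = P.1
  rw [Set.image_id']

theorem mem_maxFace_relabel (σ : I ≃ J) (P : Set (I → ℝ)) (y : J → ℝ) :
    maxFace (LinearMap.funLeft ℝ ℝ σ.symm '' P) y =
      LinearMap.funLeft ℝ ℝ σ.symm '' maxFace P (y ∘ σ) := by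
  ext x
  constructor
  · rintro ⟨⟨x, hx, rfl⟩, h⟩
    refine ⟨x, ⟨hx, fun z hz => ?_⟩, rfl⟩
    have := h _ ⟨z, hz, rfl⟩
    rwa [Polytope.dot_funLeft_symm, Polytope.dot_funLeft_symm] at this
  · rintro ⟨x, ⟨hx, h⟩, rfl⟩
    refine ⟨⟨x, hx, rfl⟩, ?_⟩
    rintro _ ⟨z, hz, rfl⟩
    rw [Polytope.dot_funLeft_symm, Polytope.dot_funLeft_symm]
    exact h z hz

theorem indL_comp_sumCongr {I' J' : Type} (α : I ≃ I') (β : J ≃ J') :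
    Polytope.indL I' J' ∘ Equiv.sumCongr α β = Polytope.indL I J := by
  ext (i | j) <;> simp [Polytope.indL]

theorem PolyClass.restrict_relabel {I' J' : Type} [Fintype I'] [Fintype J'] (α : I ≃ I')
    (β : J ≃ J') (c : PolyClass (I ⊕ J)) :
    (c.relabel (Equiv.sumCongr α β)).restrict = c.restrict.relabel α := by
  induction c using Quotient.ind with | _ P
  refine congrArg (Quotient.mk _) (Subtype.ext ?_)
  simp only [Polytope.relabel, Polytope.restrict, mem_maxFace_relabel, indL_comp_sumCongr,
    Set.image_image]
  rfl

theorem PolyClass.contract_relabel {I' J' : Type} [Fintype I'] [Fintype J'] (α : I ≃ I')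
    (β : J ≃ J') (c : PolyClass (I ⊕ J)) :
    (c.relabel (Equiv.sumCongr α β)).contract = c.contract.relabel β := by
  induction c using Quotient.ind with | _ P
  refine congrArg (Quotient.mk _) (Subtype.ext ?_)
  simp only [Polytope.relabel, Polytope.contract, mem_maxFace_relabel, indL_comp_sumCongr,
    Set.image_image]
  rfl

/-- The basis of the species of associahedra: normal equivalence classes of products of
associahedra `a_{ℓ_1} × ⋯ × a_{ℓ_k} ⊆ ℝ I`. -/
def AClass (I : Type) [Fintype I] : Type := {c : PolyClass I // IsAssocProd c}

instance (I : Type) [Fintype I] : Finite (AClass I) := by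
  have h : ∀ c : AClass I, ∃ P : Polytope I, ∃ ρ : I → I → Prop,
      c.1 = ⟦P⟧ ∧ Gen P.1 (intervals ρ) := by
    rintro ⟨_, r, ℓ, rfl⟩
    exact ⟨_, _, rfl, gen_lodayProd r ℓ⟩
  choose P ρ h1 h2 using h
  refine Finite.of_injective ρ fun c d hcd => Subtype.ext ?_
  rw [h1, h1]
  refine Quotient.sound ?_
  have := h2 d
  rw [← hcd] at this
  exact (h2 c).normalFan_eq this

namespace AClass

/-- Relabelling of basis elements. -/
def relabel (σ : I ≃ J) (c : AClass I) : AClass J := ⟨c.1.relabel σ, c.2.relabel σ⟩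

/-- Cartesian product of basis elements. -/
def prod (c : AClass I) (d : AClass J) : AClass (I ⊕ J) := ⟨c.1.prod d.1, c.2.prod d.2⟩

/-- The first factor `z|_S` of the coproduct of a basis element `z`. -/
def restrict (c : AClass (I ⊕ J)) : AClass I := ⟨c.1.restrict, c.2.restrict⟩

/-- The second factor `z/_S` of the coproduct of a basis element `z`. -/
def contract (c : AClass (I ⊕ J)) : AClass J := ⟨c.1.contract, c.2.contract⟩

end AClass

end Polytopes

/-! ### The Hopf monoid of associahedra and its dual

Decompositions `S ⊔ T` of a finite set are written as sum types `I ⊕ J`; together with the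
relabelling maps this covers all decompositions of all finite sets. -/

section Hopf
open scoped TensorProduct
variable (K : Type*) [Field K] {I J L : Type} [Fintype I] [Fintype J] [Fintype L]

/-- The vector species of associahedra: the vector space with basis `AClass I`. -/
abbrev Abar (I : Type) [Fintype I] : Type _ := AClass I →₀ K

namespace Abar

/-- The action of bijections. -/
def relabel (σ : I ≃ J) : Abar K I →ₗ[K] Abar K J := Finsupp.lmapDomain K K (AClass.relabel σ)

/-- The product `μ_{S,T}(P ⊗ Q) = P × Q`. -/
def mul (I J : Type) [Fintype I] [Fintype J] : Abar K I ⊗[K] Abar K J →ₗ[K] Abar K (I ⊕ J) :=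
  Finsupp.lmapDomain K K (fun p : AClass I × AClass J => p.1.prod p.2) ∘ₗ
    (finsuppTensorFinsupp' K (AClass I) (AClass J)).toLinearMap

/-- The coproduct `Δ_{S,T}(P) = P|_S ⊗ P/_S`. -/
def comul (I J : Type) [Fintype I] [Fintype J] : Abar K (I ⊕ J) →ₗ[K] Abar K I ⊗[K] Abar K J :=
  Finsupp.linearCombination K fun c : AClass (I ⊕ J) =>
    Finsupp.single c.restrict (1 : K) ⊗ₜ[K] Finsupp.single c.contract (1 : K)

theorem relabel_relabel (σ : I ≃ J) (τ : J ≃ L) :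
    relabel K τ ∘ₗ relabel K σ = relabel K (σ.trans τ) := by
  refine Finsupp.lhom_ext fun c a => ?_
  simp only [relabel, LinearMap.comp_apply, Finsupp.lmapDomain_apply, Finsupp.mapDomain_single]
  congr 1
  exact Subtype.ext (PolyClass.relabel_trans σ τ c.1)

theorem relabel_refl : relabel K (Equiv.refl I) = LinearMap.id := by
  refine Finsupp.lhom_ext fun c a => ?_
  simp only [relabel, LinearMap.id_apply, Finsupp.lmapDomain_apply, Finsupp.mapDomain_single]
  congr 1
  exact Subtype.ext (PolyClass.relabel_refl c.1)

theorem comul_relabel {I' J' : Type} [Fintype I'] [Fintype J'] (α : I ≃ I') (β : J ≃ J') :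
    comul K I' J' ∘ₗ relabel K (Equiv.sumCongr α β) =
      TensorProduct.map (relabel K α) (relabel K β) ∘ₗ comul K I J := by
  refine Finsupp.lhom_ext fun c a => ?_
  simp only [relabel, comul, LinearMap.comp_apply, Finsupp.lmapDomain_apply,
    Finsupp.mapDomain_single, Finsupp.linearCombination_single, map_smul, TensorProduct.map_tmul]
  have h1 : (c.relabel (Equiv.sumCongr α β)).restrict = c.restrict.relabel α :=
    Subtype.ext (PolyClass.restrict_relabel α β c.1)
  have h2 : (c.relabel (Equiv.sumCongr α β)).contract = c.contract.relabel β :=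
    Subtype.ext (PolyClass.contract_relabel α β c.1)
  rw [h1, h2]

end Abar

/-- The dual species. -/
abbrev AbarDual (I : Type) [Fintype I] : Type _ := Module.Dual K (Abar K I)

namespace AbarDual

/-- The action of bijections on the dual species. -/
def relabel (σ : I ≃ J) : AbarDual K I →ₗ[K] AbarDual K J := (Abar.relabel K σ.symm).dualMap

/-- The product of the dual Hopf monoid: the dual map of the coproduct. -/
def mul (I J : Type) [Fintype I] [Fintype J] :
    AbarDual K I ⊗[K] AbarDual K J →ₗ[K] AbarDual K (I ⊕ J) :=
  (Abar.comul K I J).dualMap ∘ₗ TensorProduct.dualDistrib K (Abar K I) (Abar K J)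

/-- The coproduct of the dual Hopf monoid: the dual map of the product. -/
def comul (I J : Type) [Fintype I] [Fintype J] :
    AbarDual K (I ⊕ J) →ₗ[K] AbarDual K I ⊗[K] AbarDual K J :=
  (TensorProduct.dualDistribEquiv K (Abar K I) (Abar K J)).symm.toLinearMap ∘ₗ
    (Abar.mul K I J).dualMap

theorem relabel_relabel (σ : I ≃ J) (τ : J ≃ L) (f : AbarDual K I) :
    relabel K τ (relabel K σ f) = relabel K (σ.trans τ) f := by
  simp only [relabel, LinearMap.dualMap_apply', LinearMap.comp_assoc, Abar.relabel_relabel]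
  rfl

theorem mul_relabel {I' J' : Type} [Fintype I'] [Fintype J'] (α : I ≃ I') (β : J ≃ J')
    (f : AbarDual K I) (g : AbarDual K J) :
    relabel K (Equiv.sumCongr α β) (mul K I J (f ⊗ₜ g)) =
      mul K I' J' (relabel K α f ⊗ₜ relabel K β g) := by
  have h : TensorProduct.dualDistrib K (Abar K I') (Abar K J')
      (relabel K α f ⊗ₜ relabel K β g) =
      TensorProduct.dualDistrib K (Abar K I) (Abar K J) (f ⊗ₜ g) ∘ₗ
        TensorProduct.map (Abar.relabel K α.symm) (Abar.relabel K β.symm) :=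
    TensorProduct.ext' fun x y => by simp [relabel]
  have h2 := Abar.comul_relabel K α.symm β.symm
  simp only [mul, LinearMap.comp_apply, LinearMap.dualMap_apply', h, LinearMap.comp_assoc, ← h2]
  rfl

end AbarDual

/-! ### The Fock functor applied to the dual Hopf monoid -/

/-- The degree `n` part of the Hopf algebra `A^*`: the `S_n`-invariants of the dual species
at `[n]`. -/
def fockPiece (n : ℕ) : Submodule K (AbarDual K (Fin n)) where
  carrier := {f | ∀ σ : Equiv.Perm (Fin n), AbarDual.relabel K σ f = f}
  add_mem' hf hg σ := by rw [map_add, hf σ, hg σ]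
  zero_mem' σ := map_zero _
  smul_mem' a f hf σ := by rw [map_smul, hf σ]

/-- The underlying graded vector space of the Hopf algebra `A^*`. -/
abbrev ADual : Type _ := DirectSum ℕ fun n => fockPiece K n

/-- The subsets `S ⊆ [s + t]` with `s` elements. -/
abbrev Shuffle (s t : ℕ) : Type := {S : Finset (Fin (s + t)) // S.card = s}

theorem Shuffle.card_compl {s t : ℕ} (S : Shuffle s t) : (S.1ᶜ).card = t := by
  rw [Finset.card_compl, Fintype.card_fin, S.2]; omega

/-- The bijection `[s] ⊔ [t] ≃ [s + t]` that identifies `[s]` with `S` and `[t]` with the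
complement of `S`, preserving the orders. -/
def Shuffle.equiv {s t : ℕ} (S : Shuffle s t) : Fin s ⊕ Fin t ≃ Fin (s + t) :=
  finSumEquivOfFinset S.2 S.card_compl

theorem Shuffle.range_equiv {s t : ℕ} (S : Shuffle s t) (k : Fin s ⊕ Fin t) :
    S.equiv k ∈ S.1 ↔ k ∈ Set.range Sum.inl := by
  rcases k with i | j
  · simp [Shuffle.equiv]
  · have := Finset.orderEmbOfFin_mem S.1ᶜ S.card_compl j
    rw [Finset.mem_compl] at this
    simpa [Shuffle.equiv] using this

/-- The product of functionals of degrees `s` and `t`: the sum over all decompositions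
`[s + t] = S ⊔ T` with `|S| = s` of the products in the dual Hopf monoid. -/
def fockMulAux (s t : ℕ) : AbarDual K (Fin s) →ₗ[K] AbarDual K (Fin t) →ₗ[K]
    AbarDual K (Fin (s + t)) :=
  ∑ S : Shuffle s t, (TensorProduct.mk K _ _).compr₂
    (AbarDual.relabel K S.equiv ∘ₗ AbarDual.mul K (Fin s) (Fin t))

theorem fockMulAux_apply (s t : ℕ) (f : AbarDual K (Fin s)) (g : AbarDual K (Fin t)) :
    fockMulAux K s t f g = ∑ S : Shuffle s t,
      AbarDual.relabel K S.equiv (AbarDual.mul K (Fin s) (Fin t) (f ⊗ₜ g)) := by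
  simp [fockMulAux, LinearMap.sum_apply]

theorem fockMulAux_mem {s t : ℕ} (f : fockPiece K s) (g : fockPiece K t) :
    fockMulAux K s t f g ∈ fockPiece K (s + t) := by
  intro σ
  rw [fockMulAux_apply, map_sum]
  let e : Shuffle s t ≃ Shuffle s t :=
    { toFun := fun S => ⟨S.1.map σ.toEmbedding, by rw [Finset.card_map, S.2]⟩
      invFun := fun S => ⟨S.1.map σ.symm.toEmbedding, by rw [Finset.card_map, S.2]⟩
      left_inv := fun S => Subtype.ext (by ext; simp)
      right_inv := fun S => Subtype.ext (by ext; simp) }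
  refine Fintype.sum_equiv e _ _ fun S => ?_
  rw [AbarDual.relabel_relabel]
  let τ : Equiv.Perm (Fin s ⊕ Fin t) := (S.equiv.trans σ).trans (e S).equiv.symm
  have hτ : Set.MapsTo τ (Set.range Sum.inl) (Set.range Sum.inl) := by
    rintro k hk
    rw [← (e S).range_equiv]
    simp only [τ, Equiv.trans_apply, Equiv.apply_symm_apply]
    exact (Finset.mem_map' σ.toEmbedding).2 ((S.range_equiv k).2 hk)
  obtain ⟨⟨α, β⟩, hαβ⟩ := Equiv.Perm.mem_sumCongrHom_range_of_perm_mapsTo_inl hτ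
  have h1 : S.equiv.trans σ = (Equiv.sumCongr α β).trans (e S).equiv := by
    have : Equiv.sumCongr α β = τ := hαβ
    rw [this]
    ext k
    simp [τ]
  rw [h1, ← AbarDual.relabel_relabel, AbarDual.mul_relabel, f.2 α, g.2 β]

/-- The product of homogeneous elements of `A^*`. -/
def fockMulHom (s t : ℕ) : fockPiece K s →ₗ[K] fockPiece K t →ₗ[K] fockPiece K (s + t) :=
  LinearMap.mk₂ K (fun f g => ⟨fockMulAux K s t f g, fockMulAux_mem K f g⟩)
    (fun f f' g => Subtype.ext (by simp)) (fun a f g => Subtype.ext (by simp))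
    (fun f g g' => Subtype.ext (by simp)) (fun a f g => Subtype.ext (by simp))

/-- The product of the Hopf algebra `A^*`. -/
def ADual.mul : ADual K →ₗ[K] ADual K →ₗ[K] ADual K :=
  DirectSum.toModule K ℕ _ fun s => LinearMap.flip <| DirectSum.toModule K ℕ _ fun t =>
    LinearMap.flip <| (fockMulHom K s t).compr₂ (DirectSum.lof K ℕ (fun n => fockPiece K n) (s + t))

theorem ADual.mul_lof (s t : ℕ) (f : fockPiece K s) (g : fockPiece K t) :
    ADual.mul K (DirectSum.lof K ℕ (fun n => fockPiece K n) s f)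
        (DirectSum.lof K ℕ (fun n => fockPiece K n) t g) =
      DirectSum.lof K ℕ (fun n => fockPiece K n) (s + t) (fockMulHom K s t f g) := by
  simp [ADual.mul]

instance (K : Type*) [Field K] : AddCommGroup (ADual K) :=
  inferInstanceAs (AddCommGroup (@DirectSum ℕ (fun n => fockPiece K n)
    fun _ => AddCommGroup.toAddCommMonoid))

/-- The commutator bracket of `A^*`. -/
def ADual.commutator (x y : ADual K) : ADual K := ADual.mul K x y - ADual.mul K y x

/-- The component `A^*_{s+t} → A^*_s ⊗ A^*_t` of the coproduct of `A^*`: the coproduct of the dual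
Hopf monoid for the decomposition of `[s + t]` into the first `s` and the last `t` elements. -/
def fockComul (s t : ℕ) : AbarDual K (Fin (s + t)) →ₗ[K]
    AbarDual K (Fin s) ⊗[K] AbarDual K (Fin t) :=
  AbarDual.comul K (Fin s) (Fin t) ∘ₗ AbarDual.relabel K finSumFinEquiv.symm

theorem dual_mem_fockPiece {n : ℕ} (φ : AClass (Fin n) → K)
    (h : ∀ (σ : Equiv.Perm (Fin n)) c, φ (c.relabel σ) = φ c) :
    Finsupp.linearCombination K φ ∈ fockPiece K n := by
  intro σ
  refine Finsupp.lhom_ext fun c a => ?_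
  simp only [AbarDual.relabel, Abar.relabel, LinearMap.dualMap_apply, Finsupp.lmapDomain_apply,
    Finsupp.mapDomain_single, Finsupp.linearCombination_single, h]

/-- The unit of `A^*`: the functional of degree `0` that is `1` on the basis element of the
species at the empty set. -/
def ADual.one : ADual K :=
  DirectSum.lof K ℕ (fun n => fockPiece K n) 0
    ⟨Finsupp.linearCombination K fun _ => 1, dual_mem_fockPiece K _ fun _ _ => rfl⟩

/-- The primitive elements of `A^*`: those `x` with `Δ(x) = x ⊗ 1 + 1 ⊗ x`, an equation that is
written out in each bidegree `(s, t)`. -/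
def ADual.primitives : Submodule K (ADual K) where
  carrier := {x | ∀ s t : ℕ, fockComul K s t (x (s + t)).1 =
    (x s).1 ⊗ₜ[K] (ADual.one K t).1 + (ADual.one K s).1 ⊗ₜ[K] (x t).1}
  add_mem' {x y} hx hy s t := by
    have hx := hx s t
    have hy := hy s t
    simp only [DirectSum.add_apply, Submodule.coe_add, map_add, TensorProduct.add_tmul,
      TensorProduct.tmul_add] at hx hy ⊢
    rw [hx, hy]; abel
  zero_mem' s t := by simp
  smul_mem' a x hx s t := by
    have hx := hx s t
    simp only [DirectSum.smul_apply, Submodule.coe_smul, map_smul, TensorProduct.smul_tmul',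
      TensorProduct.tmul_smul] at hx ⊢
    rw [hx, smul_add]; simp [TensorProduct.smul_tmul']

theorem AClass.isAssoc_relabel_iff {n : ℕ} (σ : Equiv.Perm (Fin n)) (c : AClass (Fin n)) :
    IsAssoc (c.relabel σ).1 ↔ IsAssoc c.1 := by
  refine ⟨fun h => ?_, fun h => h.relabel σ⟩
  have := h.relabel σ.symm
  simp only [AClass.relabel, PolyClass.relabel_trans] at this
  rwa [show Equiv.trans σ σ.symm = Equiv.refl _ by ext; simp, PolyClass.relabel_refl] at this

open Classical in
/-- The element `a_n^*` of `A^*`: the functional dual to the isomorphism class `a_n` of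
associahedra. It takes the value `1` on every associahedron `a_ℓ`, `ℓ` a linear order on `[n]`, and
the value `0` on all other basis elements. -/
def ADual.aStar (n : ℕ) : ADual K :=
  DirectSum.lof K ℕ (fun n => fockPiece K n) n
    ⟨Finsupp.linearCombination K fun c : AClass (Fin n) => if IsAssoc c.1 then 1 else 0,
      dual_mem_fockPiece K _ fun σ c => by simp only [AClass.isAssoc_relabel_iff]⟩

end Hopf

/-! ### The Witt algebra -/

section Witt
open LaurentPolynomial
variable (K : Type*) [Field K]

/-- The linear map `d/dz` on Laurent polynomials, `z ^ k ↦ k z ^ (k - 1)` (here `z = T 1`). -/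
def laurentDeriv : K[T;T⁻¹] →ₗ[K] K[T;T⁻¹] :=
  (Finsupp.lsum K fun k : ℤ => LinearMap.toSpanSingleton K K[T;T⁻¹] ((k : K) • T (k - 1))) ∘ₗ
    (AddMonoidAlgebra.coeffLinearEquiv K).toLinearMap

theorem laurentDeriv_T (k : ℤ) : laurentDeriv K (T k) = (k : K) • T (k - 1) := by
  change (Finsupp.lsum K fun k : ℤ => LinearMap.toSpanSingleton K K[T;T⁻¹] ((k : K) • T (k - 1)))
    (Finsupp.single k (1 : K)) = _
  simp

theorem laurent_span : Submodule.span K (Set.range (T : ℤ → K[T;T⁻¹])) = ⊤ := by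
  rw [eq_top_iff]
  rintro f -
  induction f using LaurentPolynomial.induction_on' with
  | add p q hp hq => exact add_mem hp hq
  | C_mul_T n a =>
    rw [← LaurentPolynomial.smul_eq_C_mul]
    exact Submodule.smul_mem _ _ (Submodule.subset_span ⟨n, rfl⟩)

theorem laurentDeriv_mul (f g : K[T;T⁻¹]) :
    laurentDeriv K (f * g) = f • laurentDeriv K g + g • laurentDeriv K f := by
  have hf : f ∈ Submodule.span K (Set.range (T : ℤ → K[T;T⁻¹])) := by
    rw [laurent_span]; trivial
  have hg : g ∈ Submodule.span K (Set.range (T : ℤ → K[T;T⁻¹])) := by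
    rw [laurent_span]; trivial
  induction hf using Submodule.span_induction with
  | zero => simp
  | add x y _ _ hx hy => simp only [add_mul, map_add, hx, hy, smul_eq_mul]; ring
  | smul a x _ hx =>
    simp only [smul_mul_assoc, map_smul, hx, smul_eq_mul, mul_smul_comm, smul_add]
  | mem x hx =>
    obtain ⟨m, rfl⟩ := hx
    induction hg using Submodule.span_induction with
    | zero => simp
    | add x y _ _ hx hy => simp only [mul_add, map_add, hx, hy, smul_eq_mul]; ring
    | smul a x _ hx =>
      simp only [smul_mul_assoc, map_smul, hx, smul_eq_mul, mul_smul_comm, smul_add]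
    | mem x hx =>
      obtain ⟨n, rfl⟩ := hx
      rw [← T_add, laurentDeriv_T, laurentDeriv_T, laurentDeriv_T]
      simp only [smul_eq_mul, mul_smul_comm, ← T_add]
      rw [show m + (n - 1) = m + n - 1 by ring, show n + (m - 1) = m + n - 1 by ring, ← add_smul]
      congr 1; push_cast; ring

/-- The Witt algebra: the Lie algebra of derivations of the ring of Laurent polynomials. -/
abbrev Witt : Type _ := Derivation K K[T;T⁻¹] K[T;T⁻¹]

/-- `d/dz` as a derivation. -/
def ddz : Witt K := Derivation.mk' (laurentDeriv K) (laurentDeriv_mul K)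

/-- `L_n = - z ^ (n + 1) d/dz`. -/
def wittL (n : ℤ) : Witt K := -((T (n + 1) : K[T;T⁻¹]) • ddz K)

theorem wittL_T (n k : ℤ) : wittL K n (T k) = -((k : K) • T (n + k)) := by
  simp only [wittL, ddz, Derivation.neg_apply, Derivation.smul_apply, Derivation.coe_mk',
    laurentDeriv_T, smul_eq_mul, mul_smul_comm, ← T_add]
  rw [show n + 1 + (k - 1) = n + k by ring]

theorem lie_wittL (m n : ℤ) : ⁅wittL K m, wittL K n⁆ = ((m : K) - n) • wittL K (m + n) := by
  apply Derivation.coe_injective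
  rw [← Derivation.coeFn_coe, ← Derivation.coeFn_coe (((m : K) - n) • wittL K (m + n))]
  congr 1
  refine LinearMap.ext_on (laurent_span K) ?_
  rintro _ ⟨k, rfl⟩
  simp only [Derivation.coeFn_coe, Derivation.commutator_apply, wittL_T, map_neg, Derivation.map_smul,
    Derivation.smul_apply, smul_neg, neg_neg, smul_smul]
  rw [show n + (m + k) = m + n + k by ring, show m + (n + k) = m + n + k by ring, ← sub_smul,
    ← neg_smul]
  congr 1; push_cast; ring

/-- The positive part of the Witt algebra: the Lie subalgebra with underlying space
`span {L_n : n ≥ 1}`. -/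
def wittPos : LieSubalgebra K (Witt K) where
  toSubmodule := Submodule.span K (wittL K '' Set.Ici 1)
  lie_mem' := by
    intro x y hx hy
    simp only [AddSubsemigroup.mem_carrier, AddSubmonoid.mem_toSubsemigroup,
      Submodule.mem_toAddSubmonoid] at hx hy ⊢
    induction hx using Submodule.span_induction with
    | zero => simp
    | add a b _ _ ha hb => rw [add_lie]; exact add_mem ha hb
    | smul c a _ ha => rw [smul_lie]; exact Submodule.smul_mem _ _ ha
    | mem a ha =>
      obtain ⟨m, hm, rfl⟩ := ha
      induction hy using Submodule.span_induction with
      | zero => simp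
      | add a b _ _ ha hb => rw [lie_add]; exact add_mem ha hb
      | smul c a _ ha => rw [lie_smul]; exact Submodule.smul_mem _ _ ha
      | mem b hb =>
        obtain ⟨n, hn, rfl⟩ := hb
        rw [lie_wittL]
        refine Submodule.smul_mem _ _ (Submodule.subset_span ⟨m + n, ?_, rfl⟩)
        simp only [Set.mem_Ici] at *; omega

theorem wittL_mem_wittPos {n : ℤ} (hn : 1 ≤ n) : wittL K n ∈ wittPos K :=
  Submodule.subset_span ⟨n, hn, rfl⟩
end Witt

end
end AssocWitt

/-!
A product of associahedra is encoded by a chain order `ρ` on its labels: a disjoint union of chains,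
one for each factor (`Represents`). In these terms the Hopf monoid is explicit: the product is the
disjoint union of orders, the restriction to `S` is the induced order, and the contraction by `S`
cuts the chains of the complement at the elements of `S`. The class is a single associahedron
exactly when `ρ` is total (`Represents.isAssoc_iff`), since the functions that are constant on all
intervals of `ρ` can be read off from the normal fan.

An invariant functional of positive degree is primitive exactly when it vanishes on products of two
classes on nonempty label sets. A class whose order is not total is such a product, and all total
orders on `[n]` are isomorphic, so the primitive elements are the span of the `a_n^*`, `n ≥ 1`
(`ADual.primitives_eq_span`).

The coefficient of `a_m^* a_n^*` at the class of `ρ` is the number of `S` with `|S| = m` such that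
restriction and contraction are both single associahedra (`ADual.coeff_mul_aStar`). If `ρ` is total,
this says that the complement of `S` is an interval of length `n`, and there are `m + 1` of these
(`numSplittings_of_total`). If `ρ` is not total, then `S` and its complement are the two chains of
`ρ`, a condition symmetric under complementation (`numSplittings_symm`), so these terms cancel in the
commutator. Hence `[a_m^*, a_n^*] = ((m + 1) - (n + 1)) a_{m+n}^*`, and the bijection `a_n^* ↦ L_n`
between bases is an isomorphism of Lie algebras.
-/

namespace AssocWitt

/-! ### Chain orders representing products of associahedra -/

section Representation
variable {I J : Type} [Fintype I] [Fintype J]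

/-- The chain order `ρ` represents the class `c`: the chains of `ρ` are the blocks, linearly
ordered, of a product of associahedra of class `c`. A class determines `ρ` only up to reversal of
each chain. -/
def Represents (c : PolyClass I) (ρ : I → I → Prop) : Prop :=
  IsChainOrder ρ ∧ ∃ P : Polytope I, c = ⟦P⟧ ∧ Gen P.1 (intervals ρ)

theorem IsAssocProd.exists_represents {c : PolyClass I} (hc : IsAssocProd c) :
    ∃ ρ, Represents c ρ := by
  induction c using Quotient.ind with | _ P
  obtain ⟨ρ, hρ, h⟩ := isAssocProd_mk_iff.1 hc
  exact ⟨ρ, hρ, P, rfl, h⟩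

namespace Represents

theorem congr {c : PolyClass I} {ρ τ : I → I → Prop} (h : Represents c ρ)
    (hτ : ∀ i j, ρ i j ↔ τ i j) : Represents c τ := by
  rwa [show τ = ρ from funext₂ fun i j => propext (hτ i j).symm]

theorem eq {c d : PolyClass I} {ρ : I → I → Prop} (hc : Represents c ρ) (hd : Represents d ρ) :
    c = d := by
  obtain ⟨-, P, rfl, hP⟩ := hc
  obtain ⟨-, Q, rfl, hQ⟩ := hd
  exact Quotient.sound (hP.normalFan_eq hQ)

/-- If `ρ` and a total order have the same fan, the indicator of a comparability class of `ρ`,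
which is constant on all intervals of `ρ`, is constant on the single maximal interval of the total
order. -/
theorem isAssoc_iff {c : PolyClass I} {ρ : I → I → Prop} (h : Represents c ρ) :
    IsAssoc c ↔ ∀ i j, ρ i j ∨ ρ j i := by
  classical
  obtain ⟨hρ, P, rfl, hP⟩ := h
  rw [isAssoc_mk_iff]
  refine ⟨?_, fun ht => ⟨ρ, ⟨hρ, ht⟩, hP⟩⟩
  rintro ⟨τ, ⟨hτ, ht⟩, hPτ⟩ i j
  let y : I → ℝ := fun k => if ρ i k ∨ ρ k i then 1 else 0
  have hy : ∀ a k b, ρ a k → ρ k b → y k = y a := by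
    intro a k b h1 _
    have : (ρ i k ∨ ρ k i) ↔ (ρ i a ∨ ρ a i) := by
      constructor
      · rintro (h | h)
        · exact hρ.down _ _ _ h h1
        · exact Or.inr (hρ.trans _ _ _ h1 h)
      · rintro (h | h)
        · exact Or.inl (hρ.trans _ _ _ h h1)
        · exact hρ.up _ _ _ h h1
    simp only [y, this]
  have h0 : maxFace P.1 0 ⊆ maxFace P.1 y := by
    rw [hP]
    rintro _ ⟨a, b, -, rfl⟩ k ⟨hk, -⟩
    exact ⟨hk, fun l hl => by rw [hy a k b hk.1 hk.2, hy a l b hl.1 hl.2]⟩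
  -- The `τ`-least and `τ`-greatest elements span an interval that contains all labels.
  rw [hPτ] at h0
  obtain ⟨a, -, ha⟩ := exists_least hτ Set.univ ⟨i, trivial⟩ fun _ _ _ _ => ht _ _
  have hτ' : IsChainOrder fun a b => τ b a := ⟨hτ.refl, fun _ _ _ h1 h2 => hτ.trans _ _ _ h2 h1,
    fun _ _ h1 h2 => hτ.antisymm _ _ h2 h1, fun _ _ _ _ _ => ht _ _, fun _ _ _ _ _ => ht _ _⟩
  obtain ⟨b, -, hb⟩ := exists_least hτ' Set.univ ⟨i, trivial⟩ fun _ _ _ _ => ht _ _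
  have hj := (h0 {k | τ a k ∧ τ k b} ⟨a, b, ha b trivial, rfl⟩
    (a := j) ⟨⟨ha j trivial, hb j trivial⟩, fun _ _ => le_rfl⟩).2 i ⟨ha i trivial, hb i trivial⟩
  by_contra hij
  simp only [y, if_neg hij, hρ.refl i, true_or, if_true] at hj
  linarith

theorem relabel (σ : I ≃ J) {c : PolyClass I} {ρ : I → I → Prop} (h : Represents c ρ) :
    Represents (c.relabel σ) fun a b => ρ (σ.symm a) (σ.symm b) := by
  obtain ⟨hρ, P, rfl, hP⟩ := h
  exact ⟨hρ.relabel σ, _, rfl, gen_relabel σ hP⟩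

theorem prod {c : PolyClass I} {d : PolyClass J} {ρ : I → I → Prop} {τ : J → J → Prop}
    (hc : Represents c ρ) (hd : Represents d τ) :
    Represents (c.prod d) (Sum.LiftRel ρ τ) := by
  obtain ⟨hρ, P, rfl, hP⟩ := hc
  obtain ⟨hτ, Q, rfl, hQ⟩ := hd
  refine ⟨⟨?_, ?_, ?_, ?_, ?_⟩, _, rfl, ?_⟩
  · rintro (i | i)
    · exact .inl (hρ.refl i)
    · exact .inr (hτ.refl i)
  · rintro _ _ _ (⟨h1⟩ | ⟨h1⟩) (⟨h2⟩ | ⟨h2⟩)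
    · exact .inl (hρ.trans _ _ _ h1 h2)
    · exact .inr (hτ.trans _ _ _ h1 h2)
  · rintro _ _ (⟨h1⟩ | ⟨h1⟩) (⟨h2⟩ | ⟨h2⟩)
    · exact congrArg _ (hρ.antisymm _ _ h1 h2)
    · exact congrArg _ (hτ.antisymm _ _ h1 h2)
  · rintro _ _ _ (⟨h1⟩ | ⟨h1⟩) (⟨h2⟩ | ⟨h2⟩)
    · exact (hρ.up _ _ _ h1 h2).imp .inl .inl
    · exact (hτ.up _ _ _ h1 h2).imp .inr .inr
  · rintro _ _ _ (⟨h1⟩ | ⟨h1⟩) (⟨h2⟩ | ⟨h2⟩)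
    · exact (hρ.down _ _ _ h1 h2).imp .inl .inl
    · exact (hτ.down _ _ _ h1 h2).imp .inr .inr
  · intro y y'
    rw [Polytope.maxFace_prod_subset_iff, hP, hQ]
    have eL : ∀ i j, {k | Sum.LiftRel ρ τ (.inl i) k ∧ Sum.LiftRel ρ τ k (.inl j)} =
        Sum.inl '' {k | ρ i k ∧ ρ k j} := by
      intro i j; ext (k | k) <;> simp
    have eR : ∀ i j, {k | Sum.LiftRel ρ τ (.inr i) k ∧ Sum.LiftRel ρ τ k (.inr j)} =
        Sum.inr '' {k | τ i k ∧ τ k j} := by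
      intro i j; ext (k | k) <;> simp
    constructor
    · rintro ⟨h1, h2⟩ _ ⟨_, _, ⟨hij⟩ | ⟨hij⟩, rfl⟩
      · rw [eL, argmax_image_subset_iff]; exact h1 _ ⟨_, _, hij, rfl⟩
      · rw [eR, argmax_image_subset_iff]; exact h2 _ ⟨_, _, hij, rfl⟩
    · intro h
      constructor
      · rintro _ ⟨i, j, hij, rfl⟩
        rw [← argmax_image_subset_iff, ← eL]
        exact h _ ⟨_, _, .inl hij, rfl⟩
      · rintro _ ⟨i, j, hij, rfl⟩
        rw [← argmax_image_subset_iff, ← eR]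
        exact h _ ⟨_, _, .inr hij, rfl⟩

theorem restrict {c : PolyClass (I ⊕ J)} {ρ : I ⊕ J → I ⊕ J → Prop} (hc : Represents c ρ) :
    Represents c.restrict fun a b => ρ (.inl a) (.inl b) := by
  obtain ⟨hρ, P, rfl, hP⟩ := hc
  have hρ' : IsChainOrder fun a b : I => ρ (.inl a) (.inl b) := ⟨fun _ => hρ.refl _,
    fun _ _ _ => hρ.trans _ _ _, fun _ _ h1 h2 => Sum.inl_injective (hρ.antisymm _ _ h1 h2),
    fun _ _ _ => hρ.up _ _ _, fun _ _ _ => hρ.down _ _ _⟩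
  have hρ'' : IsChainOrder fun a b : I => ρ (.inl b) (.inl a) := ⟨fun _ => hρ.refl _,
    fun _ _ _ h1 h2 => hρ.trans _ _ _ h2 h1,
    fun _ _ h1 h2 => Sum.inl_injective (hρ.antisymm _ _ h2 h1),
    fun _ _ _ h1 h2 => (hρ.down _ _ _ h1 h2).symm,
    fun _ _ _ h1 h2 => (hρ.up _ _ _ h1 h2).symm⟩
  refine ⟨hρ', _, rfl, ?_⟩
  intro y y'
  simp only [Polytope.restrict]
  rw [maxFace_image_subset_iff _ _ Polytope.dot_funLeft_inl,
    hP.maxFace P.2 (intervals_nonempty hρ), Set.forall_mem_image]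
  simp only [argmax_elim_left]
  constructor
  · rintro h _ ⟨i, j, hij, rfl⟩
    exact h (x := {k | ρ (.inl i) k ∧ ρ k (.inl j)}) ⟨_, _, hij, rfl⟩
  · rintro h _ ⟨i, j, hij, rfl⟩
    by_cases hn : (Sum.inl ⁻¹' {k | ρ i k ∧ ρ k j} : Set I).Nonempty
    · obtain ⟨a, ha, ha'⟩ := exists_least hρ' _ hn fun p hp q hq => hρ.up _ _ _ hp.1 hq.1
      obtain ⟨b, hb, hb'⟩ := exists_least hρ'' _ hn fun p hp q hq =>
        (hρ.up _ _ _ hp.1 hq.1).symm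
      have e : (Sum.inl ⁻¹' {k | ρ i k ∧ ρ k j} : Set I) =
          {k | ρ (.inl a) (.inl k) ∧ ρ (.inl k) (.inl b)} := by
        ext k
        constructor
        · intro hk; exact ⟨ha' k hk, hb' k hk⟩
        · intro hk
          exact ⟨hρ.trans _ _ _ ha.1 hk.1, hρ.trans _ _ _ hk.2 hb.2⟩
      rw [e]
      exact h _ ⟨a, b, ha' b hb, rfl⟩
    · rw [Set.not_nonempty_iff_eq_empty] at hn
      rw [hn]
      rintro i ⟨h, -⟩; exact absurd h (Set.notMem_empty i)

/-- Contraction cuts each chain at the elements of the first part. -/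
theorem contract {c : PolyClass (I ⊕ J)} {ρ : I ⊕ J → I ⊕ J → Prop} (hc : Represents c ρ) :
    Represents c.contract fun a b => ρ (.inr a) (.inr b) ∧
      ∀ i : I, ¬(ρ (.inr a) (.inl i) ∧ ρ (.inl i) (.inr b)) := by
  obtain ⟨hρ, P, rfl, hP⟩ := hc
  have sub : ∀ a b k : J, ρ (.inr a) (.inr k) → ρ (.inr k) (.inr b) →
      (∀ i : I, ¬(ρ (.inr a) (.inl i) ∧ ρ (.inl i) (.inr b))) →
      (∀ i : I, ¬(ρ (.inr a) (.inl i) ∧ ρ (.inl i) (.inr k))) ∧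
      (∀ i : I, ¬(ρ (.inr k) (.inl i) ∧ ρ (.inl i) (.inr b))) := fun a b k h1 h2 h =>
    ⟨fun i hi => h i ⟨hi.1, hρ.trans _ _ _ hi.2 h2⟩,
      fun i hi => h i ⟨hρ.trans _ _ _ h1 hi.1, hi.2⟩⟩
  refine ⟨⟨?_, ?_, ?_, ?_, ?_⟩, _, rfl, ?_⟩
  · exact fun a => ⟨hρ.refl _, fun i hi => Sum.inr_ne_inl (hρ.antisymm _ _ hi.1 hi.2)⟩
  · rintro a b c ⟨h1, h1'⟩ ⟨h2, h2'⟩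
    refine ⟨hρ.trans _ _ _ h1 h2, fun i hi => ?_⟩
    rcases hρ.up _ _ _ h1 hi.1 with h | h
    · exact h2' i ⟨h, hi.2⟩
    · exact h1' i ⟨hi.1, h⟩
  · exact fun _ _ h1 h2 => Sum.inr_injective (hρ.antisymm _ _ h1.1 h2.1)
  · rintro a b c ⟨h1, h1'⟩ ⟨h2, h2'⟩
    rcases hρ.up _ _ _ h1 h2 with h | h
    · exact Or.inl ⟨h, (sub _ _ _ h1 h h2').2⟩
    · exact Or.inr ⟨h, (sub _ _ _ h2 h h1').2⟩
  · rintro a b c ⟨h1, h1'⟩ ⟨h2, h2'⟩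
    rcases hρ.down _ _ _ h1 h2 with h | h
    · exact Or.inl ⟨h, (sub _ _ _ h h2 h1').1⟩
    · exact Or.inr ⟨h, (sub _ _ _ h h1 h2').1⟩
  · intro y y'
    simp only [Polytope.contract]
    rw [maxFace_image_subset_iff _ _ Polytope.dot_funLeft_inr,
      hP.maxFace P.2 (intervals_nonempty hρ), Set.forall_mem_image]
    simp only [argmax_elim_right]
    have e : ∀ a b : J, (∀ i : I, ¬(ρ (.inr a) (.inl i) ∧ ρ (.inl i) (.inr b))) →
        {k : J | (ρ (.inr a) (.inr k) ∧ ∀ i : I, ¬(ρ (.inr a) (.inl i) ∧ ρ (.inl i) (.inr k))) ∧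
          (ρ (.inr k) (.inr b) ∧ ∀ i : I, ¬(ρ (.inr k) (.inl i) ∧ ρ (.inl i) (.inr b)))} =
        (Sum.inr ⁻¹' {k | ρ (.inr a) k ∧ ρ k (.inr b)}) := by
      intro a b hab
      ext k
      constructor
      · rintro ⟨⟨h1, -⟩, ⟨h2, -⟩⟩; exact ⟨h1, h2⟩
      · rintro ⟨h1, h2⟩
        have := sub _ _ _ h1 h2 hab
        exact ⟨⟨h1, this.1⟩, ⟨h2, this.2⟩⟩
    constructor
    · rintro h _ ⟨a, b, ⟨hab, hab'⟩, rfl⟩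
      rw [e a b hab']
      refine h (x := {k | ρ (.inr a) k ∧ ρ k (.inr b)}) ⟨_, _, hab, rfl⟩ ?_
      ext i
      exact ⟨fun hi => absurd hi (hab' i), fun hi => absurd hi (Set.notMem_empty i)⟩
    · rintro h _ ⟨i, j, hij, rfl⟩ hS
      have hS' : ∀ k : I, ¬(ρ i (.inl k) ∧ ρ (.inl k) j) := by
        intro k hk
        have : k ∈ (Sum.inl ⁻¹' {k | ρ i k ∧ ρ k j} : Set I) := hk
        rw [hS] at this
        exact Set.notMem_empty k this
      rcases i with i | a
      · exact absurd ⟨hρ.refl _, hij⟩ (hS' i)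
      rcases j with j | b
      · exact absurd ⟨hij, hρ.refl _⟩ (hS' j)
      rw [← e a b hS']
      exact h _ ⟨a, b, ⟨hij, hS'⟩, rfl⟩

end Represents

/-- If the two parts of `I ⊔ J` are incomparable, the class is the product of its restriction and
its contraction. -/
theorem AClass.prod_restrict_contract {c : AClass (I ⊕ J)} {ρ : I ⊕ J → I ⊕ J → Prop}
    (hc : Represents c.1 ρ) (h : ∀ i j, ¬ ρ (.inl i) (.inr j) ∧ ¬ ρ (.inr j) (.inl i)) :
    c.restrict.prod c.contract = c := by
  refine Subtype.ext (Represents.eq (ρ := ρ) ?_ hc)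
  refine (hc.restrict.prod hc.contract).congr ?_
  rintro (i | i) (j | j)
  · simp
  · simp [h]
  · simp [h]
  · simp [h]

theorem AClass.isAssoc_prod_iff [Nonempty (I ⊕ J)] (c : AClass I) (d : AClass J) :
    IsAssoc (c.prod d).1 ↔ IsAssoc c.1 ∧ IsEmpty J ∨ IsEmpty I ∧ IsAssoc d.1 := by
  obtain ⟨ρ, hρ⟩ := c.2.exists_represents
  obtain ⟨τ, hτ⟩ := d.2.exists_represents
  have h : Represents (c.prod d).1 _ := hρ.prod hτ
  rw [hρ.isAssoc_iff, hτ.isAssoc_iff, h.isAssoc_iff]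
  constructor
  · intro h
    rcases isEmpty_or_nonempty J with hJ | ⟨⟨j⟩⟩
    · exact .inl ⟨fun a b => by simpa using h (.inl a) (.inl b), hJ⟩
    · refine .inr ⟨⟨fun i => by simpa using h (.inl i) (.inr j)⟩, fun a b => ?_⟩
      simpa using h (.inr a) (.inr b)
  · rintro (⟨h, hJ⟩ | ⟨hI, h⟩) (a | a) (b | b)
    all_goals first | exact isEmptyElim a | exact isEmptyElim b | simpa using h a b

/-- A total chain order on a set of `n` elements is isomorphic to the order of `Fin n`. -/
theorem IsChainOrder.exists_equiv_fin {n : ℕ} (hn : Fintype.card I = n) {ρ : I → I → Prop}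
    (hρ : IsChainOrder ρ) (ht : ∀ i j, ρ i j ∨ ρ j i) :
    ∃ σ : I ≃ Fin n, ∀ i j, ρ i j ↔ σ i ≤ σ j := by
  classical
  let _ : LinearOrder I :=
    { le := ρ, le_refl := hρ.refl, le_trans := hρ.trans, le_antisymm := hρ.antisymm,
      le_total := ht, toDecidableLE := fun _ _ => Classical.propDecidable _ }
  let e := Fintype.orderIsoFinOfCardEq I hn
  exact ⟨e.symm.toEquiv, fun i j => (e.symm.le_iff_le (x := i) (y := j)).symm⟩

/-- The associahedra on `n` labels form a single isomorphism class. -/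
theorem AClass.exists_relabel_eq {n : ℕ} {c d : AClass (Fin n)} (hc : IsAssoc c.1)
    (hd : IsAssoc d.1) : ∃ σ : Equiv.Perm (Fin n), c.relabel σ = d := by
  obtain ⟨ρ, hρ⟩ := c.2.exists_represents
  obtain ⟨τ, hτ⟩ := d.2.exists_represents
  obtain ⟨α, hα⟩ := hρ.1.exists_equiv_fin (Fintype.card_fin n) (hρ.isAssoc_iff.1 hc)
  obtain ⟨β, hβ⟩ := hτ.1.exists_equiv_fin (Fintype.card_fin n) (hτ.isAssoc_iff.1 hd)
  refine ⟨α.trans β.symm, Subtype.ext (Represents.eq (ρ := τ) ?_ hτ)⟩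
  exact (hρ.relabel (α.trans β.symm)).congr fun i j => by simp [hα, hβ]

/-- The class of the associahedron of the standard order on `Fin n`. -/
noncomputable def AClass.std (n : ℕ) : AClass (Fin n) :=
  ⟨lodayClass inferInstance, by
    obtain ⟨ρ, ⟨hρ, -⟩, h⟩ := isAssoc_mk_iff.1 ⟨(inferInstance : LinearOrder (Fin n)), rfl⟩
    exact isAssocProd_mk_iff.2 ⟨ρ, hρ, h⟩⟩

theorem AClass.isAssoc_std (n : ℕ) : IsAssoc (AClass.std n).1 := ⟨_, rfl⟩

/-- A product of at least two associahedra decomposes as a product of two classes on nonempty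
label sets: the first is a comparability class of a representing order. -/
theorem AClass.exists_eq_relabel_prod {n : ℕ} {c : AClass (Fin n)} (hc : ¬ IsAssoc c.1) :
    ∃ (s t : ℕ) (_ : 1 ≤ s) (_ : 1 ≤ t) (σ : Fin s ⊕ Fin t ≃ Fin n) (a : AClass (Fin s))
      (b : AClass (Fin t)), c = (a.prod b).relabel σ := by
  classical
  obtain ⟨ρ, hρ⟩ := c.2.exists_represents
  rw [hρ.isAssoc_iff] at hc
  push Not at hc
  obtain ⟨i, j, hij, hji⟩ := hc
  let S : Finset (Fin n) := Finset.univ.filter fun k => ρ i k ∨ ρ k i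
  have hi : i ∈ S := by simp [S, hρ.1.refl]
  have hj : j ∈ Sᶜ := by simp [S, hij, hji]
  let σ : Fin S.card ⊕ Fin (Sᶜ).card ≃ Fin n := finSumEquivOfFinset rfl rfl
  have hl : ∀ a, σ (.inl a) ∈ S := fun a => by simp [σ]
  have hr : ∀ b, σ (.inr b) ∉ S := fun b => by
    have := Finset.orderEmbOfFin_mem Sᶜ rfl b
    rw [Finset.mem_compl] at this
    simpa [σ] using this
  have hS : ∀ a ∈ S, ∀ b ∉ S, ¬ ρ a b ∧ ¬ ρ b a := by
    intro a ha b hb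
    simp only [S, Finset.mem_filter, Finset.mem_univ, true_and] at ha hb
    refine ⟨fun h => hb ?_, fun h => hb ?_⟩
    · rcases ha with ha | ha
      · exact .inl (hρ.1.trans _ _ _ ha h)
      · exact hρ.1.up _ _ _ ha h
    · rcases ha with ha | ha
      · exact hρ.1.down _ _ _ ha h
      · exact .inr (hρ.1.trans _ _ _ h ha)
  have h := AClass.prod_restrict_contract (c := c.relabel σ.symm) (hρ.relabel σ.symm)
    fun a b => hS _ (hl a) _ (hr b)
  refine ⟨_, _, Finset.card_pos.2 ⟨i, hi⟩, Finset.card_pos.2 ⟨j, hj⟩, σ,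
    (c.relabel σ.symm).restrict, (c.relabel σ.symm).contract, ?_⟩
  rw [h]
  refine Subtype.ext ?_
  change c.1 = (c.1.relabel σ.symm).relabel σ
  rw [PolyClass.relabel_trans, Equiv.symm_trans_self, PolyClass.relabel_refl]

/-! ### Counting splittings into two associahedra -/

/-- The restriction to `S` and the contraction by `S` of the class represented by `ρ` are both
single associahedra. -/
def IsSplitting (ρ : I → I → Prop) (S : Finset I) : Prop :=
  (∀ i ∈ S, ∀ j ∈ S, ρ i j ∨ ρ j i) ∧ (∀ i ∉ S, ∀ j ∉ S, ρ i j ∨ ρ j i) ∧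
    ∀ i ∉ S, ∀ j ∉ S, ∀ k ∈ S, ¬(ρ i k ∧ ρ k j)

theorem Represents.isAssoc_restrict_and_contract_iff {s t : ℕ} {c : AClass (Fin (s + t))}
    {ρ : Fin (s + t) → Fin (s + t) → Prop} (hρ : Represents c.1 ρ) (S : Shuffle s t) :
    IsAssoc (c.relabel S.equiv.symm).restrict.1 ∧ IsAssoc (c.relabel S.equiv.symm).contract.1 ↔
      IsSplitting ρ S.1 := by
  have h : Represents (c.relabel S.equiv.symm).1 fun a b => ρ (S.equiv a) (S.equiv b) :=
    hρ.relabel S.equiv.symm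
  have hl : ∀ p : Fin (s + t) → Prop, (∀ i ∈ S.1, p i) ↔ ∀ a, p (S.equiv (.inl a)) := by
    intro p
    refine ⟨fun h a => h _ ((S.range_equiv _).2 ⟨a, rfl⟩), fun h i hi => ?_⟩
    obtain ⟨k, rfl⟩ := S.equiv.surjective i
    obtain ⟨a, rfl⟩ := (S.range_equiv k).1 hi
    exact h a
  have hr : ∀ p : Fin (s + t) → Prop, (∀ i ∉ S.1, p i) ↔ ∀ a, p (S.equiv (.inr a)) := by
    intro p
    refine ⟨fun h a => h _ fun h' => ?_, fun h i hi => ?_⟩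
    · obtain ⟨b, hb⟩ := (S.range_equiv _).1 h'
      cases hb
    · obtain ⟨a | a, rfl⟩ := S.equiv.surjective i
      · exact absurd ((S.range_equiv _).2 ⟨a, rfl⟩) hi
      · exact h a
  have h1 : Represents (c.relabel S.equiv.symm).restrict.1 _ := h.restrict
  have h2 : Represents (c.relabel S.equiv.symm).contract.1 _ := h.contract
  rw [h1.isAssoc_iff, h2.isAssoc_iff]
  simp only [IsSplitting, hl, hr]
  refine and_congr_right fun _ => ⟨fun h' => ?_, fun h' a b => ?_⟩
  · refine ⟨fun a b => (h' a b).imp And.left And.left, fun a b k hk => ?_⟩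
    rcases h' a b with ⟨-, h3⟩ | ⟨h3, -⟩
    · exact h3 k hk
    · have := h.1.antisymm _ _ (h.1.trans _ _ _ hk.1 hk.2) h3
      cases this
      cases h.1.antisymm _ _ hk.1 hk.2
  · exact (h'.1 a b).imp (fun h3 => ⟨h3, fun k => h'.2 a b k⟩) fun h3 => ⟨h3, fun k => h'.2 b a k⟩

/-- When `ρ` is not total, a splitting consists of the two comparability classes of `ρ`, in either
order. -/
theorem isSplitting_compl [DecidableEq I] {ρ : I → I → Prop} (hρ : IsChainOrder ρ)
    (ht : ¬ ∀ i j, ρ i j ∨ ρ j i) {S : Finset I} (hS : IsSplitting ρ S) : IsSplitting ρ Sᶜ := by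
  obtain ⟨h1, h2, h3⟩ := hS
  simp only [IsSplitting, Finset.mem_compl, not_not]
  -- An element `k` outside `S` between two elements of `S` is comparable to everything, and then
  -- `ρ` is total.
  refine ⟨h2, h1, fun i hi j hj k hk hik => ht ?_⟩
  have hki : ∀ a ∈ S, ρ a k ∨ ρ k a := by
    intro a ha
    rcases h1 i hi a ha with h | h
    · exact (hρ.up _ _ _ hik.1 h).symm
    · exact .inl (hρ.trans _ _ _ h hik.1)
  have hcomp : ∀ a, ρ a k ∨ ρ k a := fun a => by
    by_cases ha : a ∈ S
    · exact hki a ha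
    · exact h2 a ha k hk
  intro a b
  rcases hcomp a with ha | ha <;> rcases hcomp b with hb | hb
  · exact hρ.down _ _ _ ha hb
  · exact .inl (hρ.trans _ _ _ ha hb)
  · exact .inr (hρ.trans _ _ _ hb ha)
  · exact hρ.up _ _ _ ha hb

open Classical in
/-- The number of splittings with first part of size `s`. -/
noncomputable def numSplittings (ρ : I → I → Prop) (s : ℕ) : ℕ :=
  (Finset.univ.filter fun S : Finset I => S.card = s ∧ IsSplitting ρ S).card

theorem numSplittings_symm {ρ : I → I → Prop} (hρ : IsChainOrder ρ)
    (ht : ¬ ∀ i j, ρ i j ∨ ρ j i) {s t : ℕ} (hst : s + t = Fintype.card I) :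
    numSplittings ρ s = numSplittings ρ t := by
  classical
  refine Finset.card_nbij' (fun S => Sᶜ) (fun S => Sᶜ) ?_ ?_ (fun S _ => compl_compl S)
    (fun S _ => compl_compl S)
  all_goals
    intro S hS
    simp only [Finset.coe_filter, Finset.mem_univ, true_and, Set.mem_ofPred_eq] at hS ⊢
    exact ⟨by rw [Finset.card_compl]; omega, isSplitting_compl hρ ht hS.2⟩

/-- For a linear order the complement of the first part of a splitting is an interval of given
length, and the interval is determined by its least element. -/
theorem numSplittings_of_total {ρ : I → I → Prop} (hρ : IsChainOrder ρ)
    (ht : ∀ i j, ρ i j ∨ ρ j i) {s : ℕ} (hs : s < Fintype.card I) :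
    numSplittings ρ s = s + 1 := by
  classical
  obtain ⟨σ, hσ⟩ := hρ.exists_equiv_fin rfl ht
  generalize Fintype.card I = n at *
  obtain ⟨t, ht0, rfl⟩ : ∃ t, 0 < t ∧ n = s + t := ⟨n - s, by omega, by omega⟩
  have hcardI : Fintype.card I = s + t := by rw [Fintype.card_congr σ, Fintype.card_fin]
  have hval : ∀ a, a < s + t → ∃ x, (σ x : ℕ) = a := fun a ha => ⟨σ.symm ⟨a, ha⟩, by simp⟩
  -- The first part attached to `i ≤ s` is the complement of the interval `[i, i + t)`.
  rw [← Finset.card_range (s + 1)]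
  symm
  refine Finset.card_bij (fun i _ => Finset.univ.filter fun x => ¬(i ≤ (σ x : ℕ) ∧ σ x < i + t))
    ?_ ?_ ?_
  · intro i hi
    rw [Finset.mem_range] at hi
    simp only [Finset.mem_filter, Finset.mem_univ, true_and]
    constructor
    · have h1 : (Finset.univ.filter fun x => i ≤ (σ x : ℕ) ∧ σ x < i + t).card = t := by
        refine (Finset.card_nbij (t := Finset.Ico i (i + t)) (fun x => (σ x : ℕ)) ?_ ?_ ?_).trans
          (by simp)
        · intro x hx; simpa using hx
        · intro x _ y _ h; exact σ.injective (Fin.ext h)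
        · intro a ha
          rw [Finset.coe_Ico, Set.mem_Ico] at ha
          obtain ⟨x, hx⟩ := hval a (by omega)
          exact ⟨x, by simpa [hx] using ha, hx⟩
      have h2 := Finset.card_filter_add_card_filter_not (s := (Finset.univ : Finset I))
        fun x => i ≤ (σ x : ℕ) ∧ σ x < i + t
      rw [Finset.card_univ, hcardI] at h2
      omega
    · refine ⟨fun _ _ _ _ => ht _ _, fun _ _ _ _ => ht _ _, ?_⟩
      simp only [Finset.mem_filter, Finset.mem_univ, true_and, not_not, hσ, Fin.le_def]
      intro a ha b hb k hk
      omega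
  · intro i hi j hj hij
    rw [Finset.mem_range] at hi hj
    obtain ⟨x, hx⟩ := hval i (by omega)
    obtain ⟨y, hy⟩ := hval j (by omega)
    have h1 := Finset.ext_iff.1 hij x
    have h2 := Finset.ext_iff.1 hij y
    simp only [Finset.mem_filter, Finset.mem_univ, true_and, hx, hy] at h1 h2
    omega
  · intro S hS
    simp only [Finset.mem_filter, Finset.mem_univ, true_and] at hS
    obtain ⟨hcard, -, -, hconv⟩ := hS
    let U : Finset ℕ := Sᶜ.image fun x => (σ x : ℕ)
    have hUcard : U.card = t := by
      rw [Finset.card_image_of_injective _ fun x y h => σ.injective (Fin.ext h),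
        Finset.card_compl, hcardI, hcard]
      omega
    have hU0 : U.Nonempty := Finset.card_pos.1 (by omega)
    have hmem : ∀ x, (σ x : ℕ) ∈ U ↔ x ∉ S := by
      intro x
      simp only [U, Finset.mem_image, Finset.mem_compl]
      exact ⟨fun ⟨y, hy, h⟩ => σ.injective (Fin.ext h) ▸ hy, fun h => ⟨x, h, rfl⟩⟩
    have hlt : ∀ a ∈ U, a < s + t := by
      intro a ha
      obtain ⟨x, -, rfl⟩ := Finset.mem_image.1 ha
      exact (σ x).2
    have ha := U.min'_mem hU0
    have hb := U.max'_mem hU0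
    have hUI : U = Finset.Icc (U.min' hU0) (U.max' hU0) := by
      refine Finset.Subset.antisymm (fun x hx => Finset.mem_Icc.2
        ⟨U.min'_le x hx, U.le_max' x hx⟩) fun x hx => ?_
      rw [Finset.mem_Icc] at hx
      obtain ⟨z, rfl⟩ := hval x (hx.2.trans_lt (hlt _ hb))
      obtain ⟨y, hy⟩ := hval _ (hlt _ ha)
      obtain ⟨w, hw⟩ := hval _ (hlt _ hb)
      rw [hmem]
      intro hz
      refine hconv y ((hmem y).1 (hy ▸ ha)) w ((hmem w).1 (hw ▸ hb)) z hz ?_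
      rw [hσ, hσ, Fin.le_def, Fin.le_def]
      omega
    have hlen := congrArg Finset.card hUI
    rw [Nat.card_Icc, hUcard] at hlen
    have hbl := hlt _ hb
    refine ⟨U.min' hU0, Finset.mem_range.2 (by omega), ?_⟩
    ext x
    have := hmem x
    rw [hUI, Finset.mem_Icc] at this
    rw [Finset.mem_filter, ← not_iff_not, ← this]
    simp only [Finset.mem_univ, true_and, not_not]
    omega

end Representation

/-! ### Coordinates of the product and the coproduct -/

section Coordinates
open scoped TensorProduct
variable (K : Type*) [Field K]

/-- The value of the degree `n` component of an element of `A^*` on a basis element. -/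
noncomputable def ADual.coeff (x : ADual K) {n : ℕ} (c : AClass (Fin n)) : K :=
  (x n).1 (Finsupp.single c 1)

variable {K}

namespace ADual

theorem ext_coeff {x y : ADual K} (h : ∀ (n : ℕ) (c : AClass (Fin n)), x.coeff K c = y.coeff K c) :
    x = y :=
  DFinsupp.ext fun n => Subtype.ext (Finsupp.lhom_ext' fun c => LinearMap.ext_ring (h n c))

theorem coeff_add (x y : ADual K) {n : ℕ} (c : AClass (Fin n)) :
    (x + y).coeff K c = x.coeff K c + y.coeff K c := by
  simp [coeff]

theorem coeff_sub (x y : ADual K) {n : ℕ} (c : AClass (Fin n)) :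
    (x - y).coeff K c = x.coeff K c - y.coeff K c := by
  rw [eq_sub_iff_add_eq, ← coeff_add, sub_add_cancel]

theorem coeff_smul (a : K) (x : ADual K) {n : ℕ} (c : AClass (Fin n)) :
    (a • x).coeff K c = a * x.coeff K c :=
  rfl

theorem coeff_relabel (x : ADual K) {n : ℕ} (c : AClass (Fin n)) (σ : Equiv.Perm (Fin n)) :
    x.coeff K (c.relabel σ) = x.coeff K c := by
  have h := LinearMap.congr_fun ((x n).2 σ.symm) (Finsupp.single c 1)
  simpa [AbarDual.relabel, Abar.relabel, coeff, Finsupp.mapDomain_single] using h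

theorem coeff_lof_same {n : ℕ} (f : fockPiece K n) (c : AClass (Fin n)) :
    coeff K (DirectSum.lof K ℕ (fun n => fockPiece K n) n f) c = f.1 (Finsupp.single c 1) := by
  rw [coeff, DirectSum.lof_apply]

theorem coeff_lof_of_ne {m n : ℕ} (h : m ≠ n) (f : fockPiece K m) (c : AClass (Fin n)) :
    coeff K (DirectSum.lof K ℕ (fun n => fockPiece K n) m f) c = 0 := by
  rw [coeff, DirectSum.lof_eq_of, DirectSum.of_eq_of_ne _ _ _ h.symm]
  rfl

open Classical in
theorem coeff_aStar (m : ℕ) {n : ℕ} (c : AClass (Fin n)) :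
    (aStar K m).coeff K c = if m = n ∧ IsAssoc c.1 then 1 else 0 := by
  by_cases h : m = n
  · subst h
    rw [aStar, coeff_lof_same]
    simp
  · rw [aStar, coeff_lof_of_ne h, if_neg fun h' => h h'.1]

theorem coeff_one {n : ℕ} (c : AClass (Fin n)) :
    (one K).coeff K c = if n = 0 then 1 else 0 := by
  by_cases h : n = 0
  · subst h
    rw [one, coeff_lof_same]
    simp
  · rw [one, coeff_lof_of_ne (Ne.symm h), if_neg h]

end ADual

theorem AbarDual.comul_eq_iff {I J : Type} [Fintype I] [Fintype J] (f : AbarDual K (I ⊕ J))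
    (w : AbarDual K I ⊗[K] AbarDual K J) :
    AbarDual.comul K I J f = w ↔ ∀ c d, f (Finsupp.single (c.prod d) 1) =
      TensorProduct.dualDistrib K _ _ w (Finsupp.single c 1 ⊗ₜ Finsupp.single d 1) := by
  have h : AbarDual.comul K I J f = w ↔
      (Abar.mul K I J).dualMap f = TensorProduct.dualDistrib K _ _ w := by
    rw [AbarDual.comul, LinearMap.comp_apply, LinearEquiv.coe_coe, LinearEquiv.symm_apply_eq]
    rfl
  have hm : ∀ c d, (Abar.mul K I J).dualMap f (Finsupp.single c 1 ⊗ₜ Finsupp.single d 1) =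
      f (Finsupp.single (c.prod d) 1) := by
    intro c d
    simp [Abar.mul, Finsupp.mapDomain_single]
  rw [h]
  constructor
  · intro h c d
    rw [← hm, h]
  · intro h
    refine TensorProduct.ext (Finsupp.lhom_ext' fun c => LinearMap.ext_ring
      (Finsupp.lhom_ext' fun d => LinearMap.ext_ring ?_))
    exact (hm c d).trans (h c d)

namespace ADual

/-- Primitivity in coordinates: a primitive element is a derivation, with respect to the counit, on
products of basis elements. -/
theorem mem_primitives_iff {x : ADual K} : x ∈ primitives K ↔
    ∀ (s t : ℕ) (c : AClass (Fin s)) (d : AClass (Fin t)),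
      x.coeff K ((c.prod d).relabel finSumFinEquiv) =
        x.coeff K c * (one K).coeff K d + (one K).coeff K c * x.coeff K d := by
  refine forall₂_congr fun s t => ?_
  rw [fockComul, LinearMap.comp_apply, AbarDual.comul_eq_iff]
  refine forall₂_congr fun c d => ?_
  simp [AbarDual.relabel, Abar.relabel, coeff, Finsupp.mapDomain_single]

/-- The coefficient of `a_s^* a_t^*` at a class counts the subsets `S` of size `s` for which the
restriction to `S` and the contraction by `S` are both single associahedra. -/
theorem coeff_mul_aStar (s t : ℕ) {n : ℕ} {c : AClass (Fin n)} {ρ : Fin n → Fin n → Prop}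
    (hρ : Represents c.1 ρ) :
    (mul K (aStar K s) (aStar K t)).coeff K c =
      if s + t = n then (numSplittings ρ s : K) else 0 := by
  classical
  by_cases h : s + t = n
  swap
  · rw [if_neg h, aStar, aStar, mul_lof, coeff_lof_of_ne h]
  subst h
  rw [if_pos rfl, aStar, aStar, mul_lof, coeff_lof_same]
  simp only [fockMulHom, LinearMap.mk₂_apply, fockMulAux_apply, LinearMap.sum_apply]
  have h1 : ∀ S : Shuffle s t, AbarDual.relabel K S.equiv (AbarDual.mul K (Fin s) (Fin t)
      ((Finsupp.linearCombination K fun c : AClass (Fin s) => if IsAssoc c.1 then (1 : K) else 0) ⊗ₜ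
        Finsupp.linearCombination K fun c : AClass (Fin t) => if IsAssoc c.1 then (1 : K) else 0))
      (Finsupp.single c 1) = if IsSplitting ρ S.1 then 1 else 0 := by
    intro S
    simp only [AbarDual.relabel, AbarDual.mul, Abar.relabel, Abar.comul, LinearMap.comp_apply,
      LinearMap.dualMap_apply, Finsupp.lmapDomain_apply, Finsupp.mapDomain_single,
      Finsupp.linearCombination_single, one_smul, TensorProduct.dualDistrib_apply,
      ← hρ.isAssoc_restrict_and_contract_iff S, ite_and, mul_ite, mul_one, mul_zero]
    split_ifs <;> rfl
  rw [Finset.sum_congr rfl fun S _ => h1 S, Finset.sum_boole, numSplittings]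
  congr 1
  refine Finset.card_nbij (fun S => S.1) ?_ ?_ ?_
  · intro S hS
    simpa [S.2] using hS
  · exact fun S _ T _ h => Subtype.ext h
  · intro S hS
    simp only [Finset.coe_filter, Finset.mem_univ, true_and, Set.mem_ofPred_eq] at hS
    exact ⟨⟨S, hS.1⟩, by simpa using hS.2, rfl⟩

/-- On a single associahedron the two products count `m + 1` and `n + 1` splittings. On all other
classes the splittings counted by the two products are exchanged by complementation. -/
theorem commutator_aStar {m n : ℕ} (hm : 1 ≤ m) (hn : 1 ≤ n) :
    commutator K (aStar K m) (aStar K n) = ((m : K) - n) • aStar K (m + n) := by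
  classical
  refine ext_coeff fun k c => ?_
  obtain ⟨ρ, hρ⟩ := c.2.exists_represents
  rw [commutator, coeff_sub, coeff_smul, coeff_mul_aStar _ _ hρ, coeff_mul_aStar _ _ hρ,
    coeff_aStar, add_comm n m, hρ.isAssoc_iff]
  by_cases hk : m + n = k
  swap
  · simp [hk]
  by_cases ht : ∀ i j, ρ i j ∨ ρ j i
  · rw [if_pos hk, if_pos hk, if_pos ⟨hk, ht⟩,
      numSplittings_of_total hρ.1 ht (by rw [Fintype.card_fin]; omega),
      numSplittings_of_total hρ.1 ht (by rw [Fintype.card_fin]; omega)]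
    push_cast; ring
  · rw [if_pos hk, if_pos hk, if_neg fun h => ht h.2,
      numSplittings_symm hρ.1 ht (hk.trans (Fintype.card_fin k).symm)]
    simp

/-! ### The primitive elements -/

theorem aStar_mem_primitives {n : ℕ} (hn : 1 ≤ n) : aStar K n ∈ primitives K := by
  classical
  rw [mem_primitives_iff]
  intro s t c d
  simp only [coeff_aStar, coeff_one]
  have h : IsAssoc ((c.prod d).relabel finSumFinEquiv).1 ↔ IsAssoc (c.prod d).1 := by
    refine ⟨fun h => ?_, fun h => h.relabel _⟩
    have := h.relabel finSumFinEquiv.symm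
    change IsAssoc (((c.prod d).1.relabel _).relabel _) at this
    rwa [PolyClass.relabel_trans, Equiv.self_trans_symm, PolyClass.relabel_refl] at this
  rw [h]
  rcases s with - | s
  · rcases t with - | t
    · simp [show n ≠ 0 by omega]
    · rw [AClass.isAssoc_prod_iff]
      have : IsEmpty (Fin 0) := inferInstance
      simp [this]
  · rw [AClass.isAssoc_prod_iff]
    have : IsEmpty (Fin 0) := inferInstance
    rcases t with - | t
    · simp [this]
    · simp

/-- A primitive element vanishes on every product of at least two associahedra, hence it is
determined by its values on associahedra. -/
theorem coeff_eq_zero_of_mem_primitives {x : ADual K} (hx : x ∈ primitives K) {n : ℕ}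
    {c : AClass (Fin n)} (hc : ¬ IsAssoc c.1) : x.coeff K c = 0 := by
  obtain ⟨s, t, hs, ht, σ, a, b, rfl⟩ := AClass.exists_eq_relabel_prod hc
  obtain rfl : s + t = n := by simpa using Fintype.card_congr σ
  have h : (a.prod b).relabel σ =
      ((a.prod b).relabel finSumFinEquiv).relabel (finSumFinEquiv.symm.trans σ) := by
    refine Subtype.ext ?_
    change _ = ((a.prod b).1.relabel _).relabel _
    rw [PolyClass.relabel_trans, ← Equiv.trans_assoc, Equiv.self_trans_symm, Equiv.refl_trans]
    rfl
  rw [h, coeff_relabel, mem_primitives_iff.1 hx, coeff_one, coeff_one, if_neg (by omega),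
    if_neg (by omega)]
  simp

/-- The degree `0` part of a primitive element vanishes. -/
theorem coeff_zero_of_mem_primitives {x : ADual K} (hx : x ∈ primitives K)
    (c : AClass (Fin 0)) : x.coeff K c = 0 := by
  have hu : ∀ d : AClass (Fin 0), d = c := by
    intro d
    obtain ⟨ρ, hρ⟩ := c.2.exists_represents
    obtain ⟨τ, hτ⟩ := d.2.exists_represents
    exact Subtype.ext ((hτ.congr fun i => i.elim0).eq hρ)
  have h := mem_primitives_iff.1 hx 0 0 c c
  rw [hu ((c.prod c).relabel finSumFinEquiv)] at h
  simpa [coeff_one] using h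

/-- Up to isomorphism there is one indecomposable class in each degree `n ≥ 1`, so a primitive
element is the combination of the `a_n^*` given by its values on these classes. -/
theorem primitives_eq_span :
    primitives K = Submodule.span K (Set.range fun n : ℕ => aStar K (n + 1)) := by
  classical
  refine le_antisymm (fun x hx => ?_) (Submodule.span_le.2 ?_)
  swap
  · rintro _ ⟨n, rfl⟩
    exact aStar_mem_primitives n.succ_pos
  have h : x = ∑ n ∈ (DFinsupp.support x).filter (1 ≤ ·),
      x.coeff K (AClass.std n) • aStar K n := by
    refine ext_coeff fun k c => ?_
    have hsum : ∀ s : Finset ℕ, (∑ n ∈ s, x.coeff K (AClass.std n) • aStar K n).coeff K c =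
        ∑ n ∈ s, x.coeff K (AClass.std n) * (aStar K n).coeff K c := by
      intro s
      induction s using Finset.induction_on with
      | empty => simp [coeff]
      | insert a s ha ih => rw [Finset.sum_insert ha, Finset.sum_insert ha, coeff_add, coeff_smul, ih]
    rw [hsum]
    by_cases hc : 1 ≤ k ∧ IsAssoc c.1
    · obtain ⟨σ, rfl⟩ := AClass.exists_relabel_eq (AClass.isAssoc_std k) hc.2
      rw [coeff_relabel, Finset.sum_eq_single k]
      · rw [coeff_relabel, coeff_aStar, if_pos ⟨rfl, AClass.isAssoc_std k⟩, mul_one]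
      · intro n _ hn
        rw [coeff_aStar, if_neg fun h => hn h.1, mul_zero]
      · intro hk
        have : x k = 0 := by
          by_contra h0
          exact hk (Finset.mem_filter.2 ⟨DFinsupp.mem_support_iff.2 h0, hc.1⟩)
        simp [coeff, this]
    · rw [Finset.sum_eq_zero]
      · by_cases hk : 1 ≤ k
        · exact coeff_eq_zero_of_mem_primitives hx fun h => hc ⟨hk, h⟩
        · obtain rfl : k = 0 := by omega
          exact coeff_zero_of_mem_primitives hx c
      · intro n hn
        rw [coeff_aStar, if_neg, mul_zero]
        rintro ⟨rfl, h⟩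
        exact hc ⟨(Finset.mem_filter.1 hn).2, h⟩
  rw [h]
  refine Submodule.sum_mem _ fun n hn => Submodule.smul_mem _ _ (Submodule.subset_span
    ⟨n - 1, ?_⟩)
  change aStar K (n - 1 + 1) = _
  rw [Nat.sub_add_cancel (Finset.mem_filter.1 hn).2]

/-! ### The isomorphism with the positive part of the Witt algebra -/

/-- The bracket of `A^*` as a bilinear map. -/
noncomputable def bracket (K : Type*) [Field K] : ADual K →ₗ[K] ADual K →ₗ[K] ADual K :=
  mul K - (mul K).flip

theorem bracket_apply (x y : ADual K) : bracket K x y = commutator K x y := by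
  simp [bracket, commutator]

/-- The linear map `A^* → W` that sends `a_n^*` to `L_n`: it evaluates the degree `n` component on
the associahedron. -/
noncomputable def toWitt (K : Type*) [Field K] : ADual K →ₗ[K] Witt K :=
  DirectSum.toModule K ℕ _ fun n => (LinearMap.toSpanSingleton K (Witt K) (wittL K n)) ∘ₗ
    (LinearMap.applyₗ (Finsupp.single (AClass.std n) (1 : K))) ∘ₗ (fockPiece K n).subtype

theorem toWitt_aStar (n : ℕ) : toWitt K (aStar K n) = wittL K n := by
  rw [toWitt, aStar, DirectSum.toModule_lof]
  simp [AClass.isAssoc_std]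

/-- The bracket of the Witt algebra as a bilinear map. -/
noncomputable def wittBracket (K : Type*) [Field K] : Witt K →ₗ[K] Witt K →ₗ[K] Witt K :=
  LinearMap.mk₂ K (fun D E => ⁅D, E⁆) (fun D D' E => add_lie D D' E) (fun a D E => smul_lie a D E)
    (fun D E E' => lie_add D E E') (fun a D E => lie_smul a D E)

theorem toWitt_commutator {x y : ADual K} (hx : x ∈ primitives K) (hy : y ∈ primitives K) :
    toWitt K (commutator K x y) = ⁅toWitt K x, toWitt K y⁆ := by
  rw [primitives_eq_span] at hx hy
  rw [← bracket_apply]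
  change _ = wittBracket K (toWitt K x) (toWitt K y)
  induction hx, hy using Submodule.span_induction₂ with
  | mem_mem x y hx hy =>
    obtain ⟨m, rfl⟩ := hx
    obtain ⟨n, rfl⟩ := hy
    rw [bracket_apply, commutator_aStar m.succ_pos n.succ_pos, map_smul, toWitt_aStar,
      toWitt_aStar, toWitt_aStar, wittBracket, LinearMap.mk₂_apply, lie_wittL]
    push_cast; rfl
  | zero_left y hy => simp only [map_zero, LinearMap.zero_apply]
  | zero_right x hx => simp only [map_zero]
  | add_left x y z _ _ _ h1 h2 => simp only [map_add, LinearMap.add_apply, h1, h2]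
  | add_right x y z _ _ _ h1 h2 => simp only [map_add, h1, h2]
  | smul_left a x y _ _ h => simp only [map_smul, LinearMap.smul_apply, h]
  | smul_right a x y _ _ h => simp only [map_smul, h]

theorem commutator_mem_primitives {x y : ADual K} (hx : x ∈ primitives K) (hy : y ∈ primitives K) :
    commutator K x y ∈ primitives K := by
  rw [primitives_eq_span] at hx hy
  rw [← bracket_apply]
  induction hx, hy using Submodule.span_induction₂ with
  | mem_mem x y hx hy =>
    obtain ⟨m, rfl⟩ := hx
    obtain ⟨n, rfl⟩ := hy
    rw [bracket_apply, commutator_aStar m.succ_pos n.succ_pos]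
    exact Submodule.smul_mem _ _ (aStar_mem_primitives (by omega))
  | zero_left y hy => simp
  | zero_right x hx => simp
  | add_left x y z _ _ _ h1 h2 => rw [map_add, LinearMap.add_apply]; exact add_mem h1 h2
  | add_right x y z _ _ _ h1 h2 => rw [map_add]; exact add_mem h1 h2
  | smul_left a x y _ _ h => rw [map_smul, LinearMap.smul_apply]; exact Submodule.smul_mem _ _ h
  | smul_right a x y _ _ h => rw [map_smul]; exact Submodule.smul_mem _ _ h

end ADual

open LaurentPolynomial in
theorem linearIndependent_wittL : LinearIndependent K fun n : ℕ => wittL K ((n + 1 : ℕ) : ℤ) := by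
  -- `L_n` sends `z` to `-z ^ (n + 1)`.
  let ev : Witt K →ₗ[K] ℤ →₀ K :=
    { toFun := fun D => (AddMonoidAlgebra.coeffLinearEquiv K) (D (T 1 : K[T;T⁻¹]))
      map_add' := fun D E => by simp
      map_smul' := fun a D => by simp }
  have h : (ev ∘ fun n : ℕ => wittL K ((n + 1 : ℕ) : ℤ)) =
      -(fun n : ℕ => Finsupp.single ((n : ℤ) + 1 + 1) (1 : K)) := by
    ext1 n
    have h1 : wittL K ((n + 1 : ℕ) : ℤ) (T 1) = -T ((n : ℤ) + 1 + 1) := by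
      rw [wittL_T, Int.cast_one, one_smul, Nat.cast_succ]
    change (AddMonoidAlgebra.coeffLinearEquiv K) (wittL K ((n + 1 : ℕ) : ℤ) (T 1)) = _
    rw [h1, map_neg]
    rfl
  refine LinearIndependent.of_comp ev ?_
  rw [h]
  refine LinearIndependent.neg ?_
  exact (Finsupp.linearIndependent_single_one K ℤ).comp _ fun a b h => by simpa using h

/-- The basis `a_1^*, a_2^*, …` of the space of primitive elements. -/
noncomputable def primitivesBasis (K : Type*) [Field K] : Module.Basis ℕ K (ADual.primitives K) :=
  (Module.Basis.span (v := fun n : ℕ => ADual.aStar K (n + 1))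
    (LinearIndependent.of_comp (ADual.toWitt K) (by
      simpa only [Function.comp_def, ADual.toWitt_aStar] using linearIndependent_wittL (K := K)))).map
    (LinearEquiv.ofEq _ _ ADual.primitives_eq_span.symm)

theorem coe_primitivesBasis (n : ℕ) : (primitivesBasis K n : ADual K) = ADual.aStar K (n + 1) := by
  simp [primitivesBasis, Module.Basis.span_apply]

theorem wittPos_eq_span : (wittPos K).toSubmodule =
    Submodule.span K (Set.range fun n : ℕ => wittL K ((n + 1 : ℕ) : ℤ)) := by
  refine congrArg (Submodule.span K) (Set.Subset.antisymm ?_ ?_)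
  · rintro _ ⟨n, hn, rfl⟩
    rw [Set.mem_Ici] at hn
    exact ⟨(n - 1).toNat, congrArg (wittL K) (by omega)⟩
  · rintro _ ⟨n, rfl⟩
    exact ⟨_, Set.mem_Ici.2 (by omega), rfl⟩

/-- The basis `L_1, L_2, …` of the positive part of the Witt algebra. -/
noncomputable def wittPosBasis (K : Type*) [Field K] : Module.Basis ℕ K (wittPos K) :=
  (Module.Basis.span (linearIndependent_wittL (K := K))).map
    (LinearEquiv.ofEq _ (wittPos K).toSubmodule wittPos_eq_span.symm)

theorem coe_wittPosBasis (n : ℕ) : (wittPosBasis K n : Witt K) = wittL K ((n + 1 : ℕ) : ℤ) := by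
  rw [wittPosBasis, Module.Basis.map_apply, LinearEquiv.coe_ofEq_apply]
  exact congrArg Subtype.val (Module.Basis.span_apply (linearIndependent_wittL (K := K)) n)

/-- The linear isomorphism `a_n^* ↦ L_n`. -/
noncomputable def primitivesEquiv (K : Type*) [Field K] : ADual.primitives K ≃ₗ[K] wittPos K :=
  (primitivesBasis K).equiv (wittPosBasis K) (Equiv.refl ℕ)

theorem coe_primitivesEquiv (x : ADual.primitives K) :
    (primitivesEquiv K x : Witt K) = ADual.toWitt K x := by
  have h : (wittPos K).toSubmodule.subtype ∘ₗ (primitivesEquiv K).toLinearMap =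
      ADual.toWitt K ∘ₗ (ADual.primitives K).subtype := by
    refine (primitivesBasis K).ext fun n => ?_
    change ((primitivesEquiv K (primitivesBasis K n) : wittPos K) : Witt K) =
      ADual.toWitt K (primitivesBasis K n : ADual K)
    rw [primitivesEquiv, Module.Basis.equiv_apply, Equiv.refl_apply, coe_wittPosBasis,
      coe_primitivesBasis, ADual.toWitt_aStar]
  exact LinearMap.congr_fun h x

end Coordinates
end AssocWitt

theorem mainTheorem1 (K : Type*) [Field K] [CharZero K] :
    (∀ x ∈ AssocWitt.ADual.primitives K, ∀ y ∈ AssocWitt.ADual.primitives K,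
      AssocWitt.ADual.commutator K x y ∈ AssocWitt.ADual.primitives K) ∧
    (∀ m n : ℕ, 1 ≤ m → 1 ≤ n →
      AssocWitt.ADual.commutator K (AssocWitt.ADual.aStar K m) (AssocWitt.ADual.aStar K n) =
        ((m : K) - (n : K)) • AssocWitt.ADual.aStar K (m + n)) ∧
    ∃ e : AssocWitt.ADual.primitives K ≃ₗ[K] AssocWitt.wittPos K,
      (∀ x y z : AssocWitt.ADual.primitives K,
        (z : AssocWitt.ADual K) = AssocWitt.ADual.commutator K x y → e z = ⁅e x, e y⁆) ∧
      ∀ n : ℕ, 1 ≤ n → ∃ h : AssocWitt.ADual.aStar K n ∈ AssocWitt.ADual.primitives K,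
        (e ⟨AssocWitt.ADual.aStar K n, h⟩ : AssocWitt.Witt K) = AssocWitt.wittL K (n : ℤ) := by
  refine ⟨fun x hx y hy => AssocWitt.ADual.commutator_mem_primitives hx hy,
    fun m n hm hn => AssocWitt.ADual.commutator_aStar hm hn, AssocWitt.primitivesEquiv K,
    fun x y z hz => Subtype.ext ?_, fun n hn => ⟨AssocWitt.ADual.aStar_mem_primitives hn, ?_⟩⟩
  · rw [AssocWitt.coe_primitivesEquiv, hz, AssocWitt.ADual.toWitt_commutator x.2 y.2,
      ← AssocWitt.coe_primitivesEquiv, ← AssocWitt.coe_primitivesEquiv]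
    rfl
  · rw [AssocWitt.coe_primitivesEquiv, AssocWitt.ADual.toWitt_aStar]
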